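/- Let $D\subset\mathbb R^3$ be open (for instance a domain with Lipschitz boundary) and let $Y=(0,1)^3$. Let $a(x,y)\in\mathbb R^{3\times3}$ ($x\in D$, $y\in\mathbb R^3$) satisfy, with constants $c_1,c_2>0$, $$c_1|\xi|^2\le a(x,y)\xi\cdot\xi,\qquad a(x,y)\xi\cdot\zeta\le c_2|\xi||\zeta|\qquad(x\in D,\ y\in Y,\ \xi,\zeta\in\mathbb R^3).$$ For a normed space $X$, $C^1(\bar D,X)$ denotes the maps $D\to X$ that are Fréchet differentiable in $D$ and which, together with their derivative, extend continuously to $\bar D$. Let $H_\#(\mathrm{curl},Y)$ be the space of $u\in L^2(Y)^3$ whose $Y$-periodic extension belongs to $H_{\rm loc}(\mathrm{curl},\mathbb R^3)$, and let $\tilde H_\#(\mathrm{curl},Y)$ be the space of classes of its elements, two elements being identified if they have the same curl, with the norm $\|\mathrm{curl}\,u\|_{L^2(Y)^3}$. For $r\in\{1,2,3\}$ let $N^r\in L^2(D,\tilde H_\#(\mathrm{curl},Y))$ be a solution of the cell problem $$\int_D\int_Y a(x,y)\,(e_r+\mathrm{curl}_yN^r)\cdot\mathrm{curl}_yv\,dy\,dx=0\qquad\text{for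 all }v\in L^2(D,\tilde H_\#(\mathrm{curl},Y)),$$ where $e_r$ is the $r$-th canonical basis vector. Suppose that $a$ is isotropic, i.e. $a(x,y)$ is a scalar multiple of the identity for all $x\in D$, $y\in Y$, and that $a\in C^1(\bar D,C^2_\#(\bar Y))^{3\times3}$, where $C^2_\#(\bar Y)$ is the space of $C^2$ functions on $\mathbb R^3$ with period $1$ in each variable, with the $C^2$ norm. Then $\mathrm{curl}_yN^r$ (after modification on a null set) belongs to $C^1(\bar D,C(\bar Y))^3$ and to $C^1(\bar D,H^2(Y))^3$. Moreover $N^r$ has a version, that is, a function $x\mapsto N^r(x,\cdot)\in H_\#(\mathrm{curl},Y)$ which represents the class $N^r(x)$ for almost every $x\in D$, which belongs to $C^1(\bar D,C(\bar Y))^3$ and to $C^1(\bar D,H^2(Y))^3$, and which satisfies for every $x\in D$: the periodic extension of $N^r(x,\cdot)$ is divergence-free (in the sense of distributions on $\mathbb R^3$), and $\int_YN^r(x,y)\,dy=0$. -/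

import Mathlib

open MeasureTheory Set

open scoped ContDiff ENNReal RealInnerProductSpace BoundedContinuousFunction

noncomputable section

namespace CurlCell

/-- Three-dimensional Euclidean space. -/
abbrev E : Type := EuclideanSpace ℝ (Fin 3)

/-- The `i`-th vector of the canonical basis. -/
def e (i : Fin 3) : E := EuclideanSpace.single i 1

/-- The open unit cube `Y`. -/
def cell : Set E := {y | ∀ i, y i ∈ Ioo (0 : ℝ) 1}

/-- The closed unit cube, the closure of `Y`. -/
def closedCell : Set E := {y | ∀ i, y i ∈ Icc (0 : ℝ) 1}

theorem isCompact_closedCell : IsCompact closedCell := by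
  have h : IsCompact (Set.pi univ (fun _ : Fin 3 => Icc (0 : ℝ) 1)) :=
    isCompact_univ_pi (fun _ => isCompact_Icc)
  have h2 := h.image (PiLp.continuous_toLp 2 (fun _ : Fin 3 => ℝ))
  convert h2 using 1
  ext y
  constructor
  · intro hy
    exact ⟨WithLp.ofLp y, fun i _ => hy i, rfl⟩
  · rintro ⟨z, hz, rfl⟩ i
    exact hz i (mem_univ i)

instance : CompactSpace closedCell := isCompact_iff_compactSpace.mp isCompact_closedCell

/-- Lebesgue measure on the unit cube. -/
abbrev cellMeasure : Measure E := volume.restrict cell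

/-- `L²(Y)³`. -/
abbrev L2Cell : Type := Lp E 2 cellMeasure

/-! ### Continuously differentiable maps up to the boundary -/

/-- `u ∈ C¹(D̄, X)` for an open set `D`: the map `u` is Fréchet differentiable in `D`, and `u` and
its derivative are continuous up to the boundary of `D`. -/
def IsC1Closure {X : Type*} [NormedAddCommGroup X] [NormedSpace ℝ X] (D : Set E) (u : E → X) :
    Prop :=
  ContinuousOn u (closure D) ∧
    ∃ u' : E → E →L[ℝ] X, ContinuousOn u' (closure D) ∧ ∀ x ∈ D, HasFDerivAt u (u' x) x

/-- The `Y`-periodic functions of class `C²`, with the `C²` norm. An element is a triple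
consisting of a function together with its (continuous, bounded) first and second partial
derivatives. -/
def PerC2 : Submodule ℝ
    ((E →ᵇ ℝ) × (Fin 3 → (E →ᵇ ℝ)) × (Fin 3 → Fin 3 → (E →ᵇ ℝ))) where
  carrier := {p | (∀ i y, HasLineDerivAt ℝ p.1 (p.2.1 i y) y (e i)) ∧
    (∀ i j y, HasLineDerivAt ℝ (p.2.1 i) (p.2.2 i j y) y (e j)) ∧
    ∀ i y, p.1 (y + e i) = p.1 y}
  add_mem' := by
    rintro p q ⟨h1, h2, h3⟩ ⟨k1, k2, k3⟩
    exact ⟨fun i y => HasDerivAt.add (h1 i y) (k1 i y),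
      fun i j y => HasDerivAt.add (h2 i j y) (k2 i j y),
      fun i y => congrArg₂ (· + ·) (h3 i y) (k3 i y)⟩
  zero_mem' := ⟨fun _ _ => hasDerivAt_const _ (0 : ℝ), fun _ _ _ => hasDerivAt_const _ (0 : ℝ),
    fun _ _ => rfl⟩
  smul_mem' := by
    rintro c p ⟨h1, h2, h3⟩
    exact ⟨fun i y => HasDerivAt.const_smul c (h1 i y),
      fun i j y => HasDerivAt.const_smul c (h2 i j y),
      fun i y => congrArg (c • ·) (h3 i y)⟩

/-- `f ∈ C¹(D̄, C²_#(Y))`, for a function `f` of `x ∈ D` and `y ∈ ℝ³`. -/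
def MemC1C2Per (D : Set E) (f : E → E → ℝ) : Prop :=
  ∃ F : E → PerC2, IsC1Closure D F ∧ ∀ x ∈ D, ∀ y, f x y = (F x).1.1 y

/-- `f ∈ C¹(D̄, C(Ȳ))³`. -/
def MemC1C (D : Set E) (f : E → E → E) : Prop :=
  ∃ F : E → C(closedCell, E), IsC1Closure D F ∧ ∀ x ∈ D, ∀ y : closedCell, f x y = F x y

/-! ### The Sobolev space `H²(Y)³` -/

/-- `w` is the weak partial derivative `∂u/∂yᵢ` in the open cube `Y`. -/
def IsWeakPartial (i : Fin 3) (u w : E → E) : Prop :=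
  ∀ φ : E → ℝ, ContDiff ℝ ∞ φ → HasCompactSupport φ → tsupport φ ⊆ cell →
    ∫ y in cell, (fderiv ℝ φ y (e i)) • u y = - ∫ y in cell, φ y • w y

theorem integrable_test_smul {μ : Measure E} [IsLocallyFiniteMeasure μ] (ψ : E → ℝ)
    (hψ : Continuous ψ) (hc : HasCompactSupport ψ) (u : Lp E 2 μ) :
    Integrable (fun y => ψ y • u y) μ :=
  ((Lp.memLp u).locallyIntegrable (by norm_num)).integrable_smul_left_of_hasCompactSupport hψ hc

theorem continuous_fderiv_dir {F : Type*} [NormedAddCommGroup F] [NormedSpace ℝ F] {φ : E → F}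
    (hφ : ContDiff ℝ ∞ φ) (v : E) : Continuous fun y => fderiv ℝ φ y v :=
  (hφ.continuous_fderiv (by simp)).clm_apply continuous_const

theorem isWeakPartial_add {i : Fin 3} {u w u' w' : L2Cell} (h : IsWeakPartial i u w)
    (h' : IsWeakPartial i u' w') : IsWeakPartial i (u + u' : L2Cell) (w + w' : L2Cell) := by
  intro φ hφ hc hs
  have A (ψ : E → ℝ) (hψ : Continuous ψ) (hcψ : HasCompactSupport ψ) (f g : L2Cell) :
      ∫ y in cell, ψ y • (f + g : L2Cell) y =
        (∫ y in cell, ψ y • f y) + ∫ y in cell, ψ y • g y := by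
    rw [← integral_add (integrable_test_smul ψ hψ hcψ f) (integrable_test_smul ψ hψ hcψ g)]
    refine integral_congr_ae ?_
    filter_upwards [Lp.coeFn_add f g] with y hy
    rw [hy, Pi.add_apply, smul_add]
  have hcd : HasCompactSupport fun y => fderiv ℝ φ y (e i) := hc.fderiv_apply ℝ (e i)
  rw [A _ (continuous_fderiv_dir hφ (e i)) hcd, A _ hφ.continuous hc, h φ hφ hc hs,
    h' φ hφ hc hs, neg_add]

theorem isWeakPartial_smul {i : Fin 3} {u w : L2Cell} (c : ℝ) (h : IsWeakPartial i u w) :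
    IsWeakPartial i (c • u : L2Cell) (c • w : L2Cell) := by
  intro φ hφ hc hs
  have A (ψ : E → ℝ) (f : L2Cell) :
      ∫ y in cell, ψ y • (c • f : L2Cell) y = c • ∫ y in cell, ψ y • f y := by
    rw [← integral_smul]
    refine integral_congr_ae ?_
    filter_upwards [Lp.coeFn_smul c f] with y hy
    rw [hy, Pi.smul_apply, smul_comm]
  rw [A, A, h φ hφ hc hs, smul_neg]

theorem isWeakPartial_zero (i : Fin 3) : IsWeakPartial i (0 : L2Cell) (0 : L2Cell) := by
  intro φ _ _ _
  have A (ψ : E → ℝ) : ∫ y in cell, ψ y • (0 : L2Cell) y = 0 := by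
    rw [integral_congr_ae (g := fun _ => (0 : E)), integral_zero]
    filter_upwards [Lp.coeFn_zero E 2 cellMeasure] with y hy
    rw [hy, Pi.zero_apply, smul_zero]
  rw [A, A, neg_zero]

/-- The Sobolev space `H²(Y)³`. An element is a triple consisting of a function in `L²(Y)³`
together with its weak first and second partial derivatives, which lie in `L²(Y)³`; the norm
(the maximum of the `L²` norms) is equivalent to the usual one. -/
def H2Cell : Submodule ℝ (L2Cell × (Fin 3 → L2Cell) × (Fin 3 → Fin 3 → L2Cell)) where
  carrier := {p | (∀ i, IsWeakPartial i p.1 (p.2.1 i)) ∧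
    ∀ i j, IsWeakPartial j (p.2.1 i) (p.2.2 i j)}
  add_mem' := by
    rintro p q ⟨h1, h2⟩ ⟨k1, k2⟩
    exact ⟨fun i => isWeakPartial_add (h1 i) (k1 i),
      fun i j => isWeakPartial_add (h2 i j) (k2 i j)⟩
  zero_mem' := ⟨fun i => isWeakPartial_zero i, fun _ j => isWeakPartial_zero j⟩
  smul_mem' := by
    rintro c p ⟨h1, h2⟩
    exact ⟨fun i => isWeakPartial_smul c (h1 i), fun i j => isWeakPartial_smul c (h2 i j)⟩

/-- `f ∈ C¹(D̄, H²(Y))³`. -/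
def MemC1H2 (D : Set E) (f : E → E → E) : Prop :=
  ∃ F : E → H2Cell, IsC1Closure D F ∧ ∀ x ∈ D, (F x).1.1 =ᵐ[cellMeasure] f x

/-! ### Periodic functions with a square integrable curl -/

/-- The point of `[0, 1)³` that is congruent to `y` modulo `ℤ³`. -/
def cellFract (y : E) : E := WithLp.toLp 2 fun i => Int.fract (y i)

/-- The `Y`-periodic extension to `ℝ³` of a function on `Y`. -/
def perExt (u : E → E) (y : E) : E := u (cellFract y)

/-- The classical curl of a differentiable vector field. -/
def curl (φ : E → E) (y : E) : E :=
  !₂[fderiv ℝ φ y (e 1) 2 - fderiv ℝ φ y (e 2) 1,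
     fderiv ℝ φ y (e 2) 0 - fderiv ℝ φ y (e 0) 2,
     fderiv ℝ φ y (e 0) 1 - fderiv ℝ φ y (e 1) 0]

/-- The distributional curl on `ℝ³` of the periodic extension of `u` is the periodic extension
of `w`. -/
def IsPerWeakCurl (u w : E → E) : Prop :=
  ∀ φ : E → E, ContDiff ℝ ∞ φ → HasCompactSupport φ →
    ∫ y, ⟪perExt u y, curl φ y⟫ = ∫ y, ⟪perExt w y, φ y⟫

theorem ae_cellFract_mem : ∀ᵐ y : E, cellFract y ∈ cell := by
  have h1 : ∀ i : Fin 3, ∀ᵐ y : E, y i ∉ range (Int.cast : ℤ → ℝ) := by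
    intro i
    have q : Measure.QuasiMeasurePreserving (fun y : E => y i) volume volume :=
      (Measure.quasiMeasurePreserving_eval (fun _ : Fin 3 => (volume : Measure ℝ)) i).comp
        (PiLp.volume_preserving_ofLp (Fin 3)).quasiMeasurePreserving
    exact q.ae ((countable_range _).ae_notMem _)
  filter_upwards [ae_all_iff.2 h1] with y hy i
  refine ⟨lt_of_le_of_ne (Int.fract_nonneg _) fun h0 => hy i ?_, Int.fract_lt_one _⟩
  exact ⟨⌊y i⌋, (Int.fract_eq_iff.1 h0.symm).2.2.elim fun z hz => by
    have : Int.fract (y i) = 0 := h0.symm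
    rw [Int.fract] at this
    linarith⟩

/-- The vector with the given integer coordinates. -/
def latticeVec (k : Fin 3 → ℤ) : E := WithLp.toLp 2 fun i => (k i : ℝ)

theorem cellFract_eq (y : E) : cellFract y = y - latticeVec fun i => ⌊y i⌋ := by
  ext i
  simp only [cellFract, latticeVec, PiLp.sub_apply]
  exact (Int.self_sub_floor (y i)).symm

theorem cellFract_of_sub_mem {y : E} {k : Fin 3 → ℤ} (h : y - latticeVec k ∈ cell) :
    cellFract y = y - latticeVec k := by
  ext i
  have hi := h i
  simp only [latticeVec, PiLp.sub_apply] at hi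
  simp only [cellFract, latticeVec, PiLp.sub_apply]
  rw [Int.fract_eq_iff]
  exact ⟨hi.1.le, hi.2, k i, by ring⟩

theorem measurableSet_cell : MeasurableSet cell := by
  have : cell = ⋂ i : Fin 3, (fun y : E => y i) ⁻¹' Ioo 0 1 := by
    ext y; simp [cell]
  rw [this]
  exact MeasurableSet.iInter fun i => (by fun_prop : Measurable fun y : E => y i) measurableSet_Ioo

theorem perExt_congr {u v : E → E} (h : u =ᵐ[cellMeasure] v) : perExt u =ᵐ[volume] perExt v := by
  have h' : ∀ᵐ y : E, y ∈ cell → u y = v y := (ae_restrict_iff' measurableSet_cell).1 h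
  have h2 : ∀ k : Fin 3 → ℤ, ∀ᵐ y : E, y - latticeVec k ∈ cell →
      u (y - latticeVec k) = v (y - latticeVec k) := fun k =>
    (measurePreserving_sub_right volume (latticeVec k)).quasiMeasurePreserving.ae h'
  filter_upwards [ae_all_iff.2 h2, ae_cellFract_mem] with y hy hc
  rw [cellFract_eq] at hc
  simp only [perExt, cellFract_eq]
  exact hy _ hc

theorem locallyIntegrable_perExt (u : L2Cell) : LocallyIntegrable (perExt u) volume := by
  have : IsFiniteMeasure cellMeasure := ⟨by
    rw [Measure.restrict_apply_univ]
    refine lt_of_le_of_lt (measure_mono ?_) isCompact_closedCell.measure_lt_top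
    exact fun y hy i => ⟨(hy i).1.le, (hy i).2.le⟩⟩
  have hu : IntegrableOn u cell volume := (Lp.memLp u).integrable (by norm_num)
  have hk (k : Fin 3 → ℤ) :
      IntegrableOn (perExt u) ((fun y : E => y - latticeVec k) ⁻¹' cell) volume := by
    have := ((measurePreserving_sub_right volume (latticeVec k)).integrableOn_comp_preimage
      (measurableEmbedding_subRight (latticeVec k))).2 hu
    refine this.congr_fun (fun y hy => ?_)
      (measurableSet_cell.preimage (measurable_sub_const (latticeVec k)))
    simp only [perExt, Function.comp_apply]
    rw [cellFract_of_sub_mem hy]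
  rw [locallyIntegrable_iff]
  intro K hK
  obtain ⟨R, hR⟩ := hK.isBounded.exists_norm_le
  obtain ⟨M, hM⟩ := exists_nat_ge (R + 1)
  let s : Finset (Fin 3 → ℤ) := Fintype.piFinset fun _ => Finset.Icc (-(M : ℤ)) M
  have hs : IntegrableOn (perExt u)
      (⋃ k ∈ s, (fun y : E => y - latticeVec k) ⁻¹' cell) volume :=
    integrableOn_finset_iUnion.2 fun k _ => hk k
  refine hs.mono_set_ae ?_
  filter_upwards [ae_cellFract_mem] with y hy hyK
  rw [cellFract_eq] at hy
  refine mem_iUnion₂.2 ⟨fun i => ⌊y i⌋, ?_, hy⟩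
  rw [Fintype.mem_piFinset]
  intro i
  have hn : |y i| ≤ R := (PiLp.norm_apply_le y i).trans (hR y hyK)
  obtain ⟨ha, hb⟩ := abs_le.1 hn
  rw [Finset.mem_Icc]
  constructor
  · rw [Int.le_floor]
    push_cast
    linarith
  · have := Int.floor_le (y i)
    have h3 : ((⌊y i⌋ : ℤ) : ℝ) ≤ ((M : ℤ) : ℝ) := by push_cast; linarith
    exact_mod_cast h3

theorem integrable_perExt_inner (u : L2Cell) {ψ : E → E} (hψ : Continuous ψ)
    (hc : HasCompactSupport ψ) : Integrable (fun y => ⟪perExt u y, ψ y⟫) volume := by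
  have hK : IntegrableOn (perExt u) (tsupport ψ) volume :=
    (locallyIntegrable_perExt u).integrableOn_isCompact hc
  obtain ⟨C, hC⟩ := hc.exists_bound_of_continuous hψ
  have h1 : IntegrableOn (fun y => ⟪perExt u y, ψ y⟫) (tsupport ψ) volume := by
    refine (hK.norm.mul_const C).mono'
      (hK.aestronglyMeasurable.inner hψ.aestronglyMeasurable) ?_
    exact Filter.Eventually.of_forall fun y =>
      (norm_inner_le_norm _ _).trans (mul_le_mul_of_nonneg_left (hC y) (norm_nonneg _))
  refine (integrableOn_iff_integrable_of_support_subset ?_).1 h1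
  intro y hy
  refine subset_tsupport ψ fun h0 => hy ?_
  simp [h0]

theorem continuous_curl {φ : E → E} (hφ : ContDiff ℝ ∞ φ) : Continuous (curl φ) := by
  have h (i j : Fin 3) : Continuous fun y => fderiv ℝ φ y (e i) j :=
    (by fun_prop : Continuous fun z : E => z j).comp (continuous_fderiv_dir hφ (e i))
  refine (PiLp.continuous_toLp 2 (fun _ : Fin 3 => ℝ)).comp (continuous_pi fun i => ?_)
  fin_cases i
  · exact (h 1 2).sub (h 2 1)
  · exact (h 2 0).sub (h 0 2)
  · exact (h 0 1).sub (h 1 0)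

theorem hasCompactSupport_curl {φ : E → E} (hc : HasCompactSupport φ) :
    HasCompactSupport (curl φ) := by
  refine (hc.fderiv ℝ).mono fun y hy h0 => hy ?_
  ext i
  fin_cases i <;> simp [curl, h0]

theorem isPerWeakCurl_add {u w u' w' : L2Cell} (h : IsPerWeakCurl u w)
    (h' : IsPerWeakCurl u' w') : IsPerWeakCurl (u + u' : L2Cell) (w + w' : L2Cell) := by
  intro φ hφ hc
  have A (ψ : E → E) (hψ : Continuous ψ) (hcψ : HasCompactSupport ψ) (f g : L2Cell) :
      ∫ y, ⟪perExt (f + g : L2Cell) y, ψ y⟫ =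
        (∫ y, ⟪perExt f y, ψ y⟫) + ∫ y, ⟪perExt g y, ψ y⟫ := by
    rw [← integral_add (integrable_perExt_inner f hψ hcψ) (integrable_perExt_inner g hψ hcψ)]
    refine integral_congr_ae ?_
    filter_upwards [perExt_congr (Lp.coeFn_add f g)] with y hy
    rw [hy, ← inner_add_left]
    rfl
  rw [A _ (continuous_curl hφ) (hasCompactSupport_curl hc), A _ hφ.continuous hc, h φ hφ hc,
    h' φ hφ hc]

theorem isPerWeakCurl_smul {u w : L2Cell} (c : ℝ) (h : IsPerWeakCurl u w) :
    IsPerWeakCurl (c • u : L2Cell) (c • w : L2Cell) := by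
  intro φ hφ hc
  have A (ψ : E → E) (f : L2Cell) :
      ∫ y, ⟪perExt (c • f : L2Cell) y, ψ y⟫ = c * ∫ y, ⟪perExt f y, ψ y⟫ := by
    rw [← integral_const_mul]
    refine integral_congr_ae ?_
    filter_upwards [perExt_congr (Lp.coeFn_smul c f)] with y hy
    rw [hy, ← real_inner_smul_left]
    rfl
  rw [A, A, h φ hφ hc]

theorem isPerWeakCurl_zero : IsPerWeakCurl (0 : L2Cell) (0 : L2Cell) := by
  intro φ _ _
  have A (ψ : E → E) : ∫ y, ⟪perExt (0 : L2Cell) y, ψ y⟫ = 0 := by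
    rw [integral_congr_ae (g := fun _ => (0 : ℝ)), integral_zero]
    filter_upwards [perExt_congr (Lp.coeFn_zero E 2 cellMeasure)] with y hy
    rw [hy]
    simp [perExt]
  rw [A, A]

/-- `H_#(curl, Y)`: the functions in `L²(Y)³` whose periodic extension belongs to
`H_loc(curl, ℝ³)`. An element is a pair consisting of a function and its curl. -/
def HCurlPer : Submodule ℝ (L2Cell × L2Cell) where
  carrier := {p | IsPerWeakCurl p.1 p.2}
  add_mem' := fun h k => isPerWeakCurl_add h k
  zero_mem' := isPerWeakCurl_zero
  smul_mem' := fun c _ h => isPerWeakCurl_smul c h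

/-- The curl operator from `H_#(curl, Y)` to `L²(Y)³`. -/
def curlMap : HCurlPer →ₗ[ℝ] L2Cell := (LinearMap.snd ℝ L2Cell L2Cell).comp HCurlPer.subtype

/-- `H̃_#(curl, Y)`: the space of classes of functions in `H_#(curl, Y)`, where two functions are
identified if they have the same curl. -/
def HTilde : Type := HCurlPer ⧸ LinearMap.ker curlMap

instance : AddCommGroup HTilde := inferInstanceAs (AddCommGroup (HCurlPer ⧸ LinearMap.ker curlMap))

instance : Module ℝ HTilde := inferInstanceAs (Module ℝ (HCurlPer ⧸ LinearMap.ker curlMap))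

/-- The class in `H̃_#(curl, Y)` of a function in `H_#(curl, Y)`. -/
def HTilde.mk : HCurlPer →ₗ[ℝ] HTilde := (LinearMap.ker curlMap).mkQ

/-- The curl of an element of `H̃_#(curl, Y)`. -/
def HTilde.curl : HTilde →ₗ[ℝ] L2Cell := (LinearMap.ker curlMap).liftQ curlMap le_rfl

theorem HTilde.curl_injective : Function.Injective HTilde.curl :=
  LinearMap.ker_eq_bot.1 (Submodule.ker_liftQ_eq_bot _ _ le_rfl le_rfl)

/-- The norm `‖φ‖ = ‖curl φ‖` in `L²(Y)³`. -/
instance : NormedAddCommGroup HTilde :=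
  NormedAddCommGroup.induced HTilde L2Cell HTilde.curl HTilde.curl_injective

instance : NormedSpace ℝ HTilde := NormedSpace.induced ℝ HTilde L2Cell HTilde.curl

/-- The distributional divergence on `ℝ³` of the periodic extension of `u` vanishes. -/
def IsPerDivFree (u : E → E) : Prop :=
  ∀ φ : E → ℝ, ContDiff ℝ ∞ φ → HasCompactSupport φ → ∫ y, fderiv ℝ φ y (perExt u y) = 0

/-- `N ∈ L²(D, H̃_#(curl, Y))` solves the cell problem with the coefficient `a` and the
direction `ξ`. -/
def IsCellSolution (D : Set E) (a : E → E → Matrix (Fin 3) (Fin 3) ℝ) (ξ : E)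
    (N : Lp HTilde 2 (volume.restrict D)) : Prop :=
  ∀ v : Lp HTilde 2 (volume.restrict D),
    ∫ x in D, ∫ y in cell,
      ⟪(a x y).toEuclideanLin (ξ + HTilde.curl (N x) y), HTilde.curl (v x) y⟫ = 0

end CurlCell

end

open CurlCell

/-! Write `a = α • 1`, fix `x`, and put `w = curl N`, `u = e_r + w`. The curls of periodic fields
are exactly the mean-free divergence-free fields (`divFree`), so the cell problem at `x` says that
`w` lies in `divFree` and `α u` is orthogonal to `divFree`. Compressing multiplication by `α` to
this closed subspace and adding the identity on its complement gives a coercive, hence invertible,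
operator `cellOp α`. Its inverse yields `w` as an explicit function `cellSol` of `α`.

Regularity rests on isotropy. Testing with the curl of `α⁻¹ m` for Fourier modes `m` gives `curl u =
-(∇α/α) × u` (`crossC_coef_of_orthogonal`), whose right side involves no derivative of `u`. Since
`w` is divergence-free and mean-free, `curl curl w = -Δ w`, so `w = -curl (-Δ)⁻¹ s` with `s = (∇α/α)
× u` (`coef_cellSol`). The operators `∂ᵢ curl (-Δ)⁻¹` are bounded Fourier multipliers. Thus `s` in
`L²` gives `∂ᵢ w` in `L²`; as `∇α/α` is `C¹`, also `∂ᵢ s` is in `L²`, and a second application gives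
the second derivatives of `w`. The outcome is one formula (`besselSeq`, `bessel_besselSeq`) for the
square summable coefficients of `(1 - Δ) w`. The operator `(1 - Δ)⁻¹` maps `ℓ²` boundedly into `H²`
(`toH2`) and, because the squares of `(1 + 4π²|k|²)⁻¹` are summable over `ℤ³`, into bounded
continuous fields (`toBCF`).

Dependence on `x` is obtained by composition: `besselSeq` is built from bounded linear and bilinear
maps and inversion in Banach algebras, so it is a `C¹` function of the coefficient wherever the
latter is bounded below (`contDiffAt_besselSeq`). The lower bound persists on the closure of `D`,
which gives continuity of the derivative up to the boundary.

The version of `N` is `curl (-Δ)⁻¹ w`. It has curl `w`, zero divergence and zero mean, and inherits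
all regularity because `curl (-Δ)⁻¹` is bounded and commutes with `(1 - Δ)⁻¹`. Finally, the given
solution satisfies its equation only after integration over `D`; localised test functions and
coercivity identify it almost everywhere with the pointwise one (`ae_eq_of_isCellSolution`). -/

noncomputable section

namespace CurlCell

/-! ### Parseval's identity on the cube -/

section Parseval

local instance : MeasureSpace UnitAddCircle := ⟨AddCircle.haarAddCircle⟩

local instance : Measure.IsAddHaarMeasure (volume : Measure UnitAddCircle) :=
  inferInstanceAs (Measure.IsAddHaarMeasure AddCircle.haarAddCircle)

local instance : IsProbabilityMeasure (volume : Measure UnitAddCircle) :=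
  inferInstanceAs (IsProbabilityMeasure AddCircle.haarAddCircle)

/-- The exponential `exp (2πi k·y)`. -/
def expo (k : Fin 3 → ℤ) (y : E) : ℂ := Complex.exp (2 * Real.pi * Complex.I * (∑ j, k j * y j : ℝ))

theorem expo_eq_mFourier (k : Fin 3 → ℤ) (y : E) :
    expo k y = UnitAddTorus.mFourier k (fun i => (y i : UnitAddCircle)) := by
  simp only [expo, UnitAddTorus.mFourier, ContinuousMap.coe_mk, fourier_coe_apply]
  rw [← Complex.exp_sum, Complex.ofReal_sum, Finset.mul_sum]
  congr 1
  refine Finset.sum_congr rfl fun j _ => ?_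
  push_cast
  ring

/-- The representative in `(0, 1]³` of a point of the torus. -/
def torusRep (t : UnitAddTorus (Fin 3)) : E :=
  WithLp.toLp 2 (UnitAddTorus.measurableEquivPiIoc (fun _ : Fin 3 => (0 : ℝ)) t).1

theorem coe_torusRep (t : UnitAddTorus (Fin 3)) :
    (fun i => ((torusRep t) i : UnitAddCircle)) = t :=
  (UnitAddTorus.measurableEquivPiIoc (fun _ : Fin 3 => (0 : ℝ))).symm_apply_apply t

theorem measurePreserving_torusRep : MeasurePreserving torusRep volume cellMeasure := by
  have hs : MeasurableSet {x : Fin 3 → ℝ | ∀ i, x i ∈ Ioc (0 : ℝ) (0 + 1)} :=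
    MeasurableSet.univ_pi' (fun i => measurableSet_Ioc)
  have h1 := (measurePreserving_subtype_coe (μa := (volume : Measure (Fin 3 → ℝ))) hs).comp
    (UnitAddTorus.measurePreserving_equivPiIoc (fun _ : Fin 3 => (0 : ℝ)))
  have h2 : MeasurePreserving (WithLp.toLp 2 : (Fin 3 → ℝ) → E)
      (volume.restrict {x : Fin 3 → ℝ | ∀ i, x i ∈ Ioc (0 : ℝ) (0 + 1)}) cellMeasure := by
    have h3 := (PiLp.volume_preserving_toLp (Fin 3)).restrict_preimage
      (s := {x : E | ∀ i, x i ∈ Ioc (0 : ℝ) (0 + 1)})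
      ((PiLp.volume_preserving_ofLp (Fin 3)).measurable hs)
    -- The half-open and the open cube differ only by points with an integer coordinate, a null set.
    have h4 : volume.restrict {x : E | ∀ i, x i ∈ Ioc (0 : ℝ) (0 + 1)} = cellMeasure := by
      refine Measure.restrict_congr_set ?_
      filter_upwards [ae_cellFract_mem] with y hy
      refine propext ⟨fun h i => ?_, fun h i => ?_⟩
      · have h1 := h i
        simp only [zero_add, mem_Ioc] at h1
        refine ⟨h1.1, lt_of_le_of_ne h1.2 fun h2 => ?_⟩
        have := (hy i).1
        simp [cellFract, h2] at this
      · have h1 := h i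
        simp only [zero_add]
        exact ⟨h1.1, h1.2.le⟩
    rw [h4] at h3
    exact h3
  exact h2.comp h1

/-- Transported along `torusRep`, this is Parseval's identity on the torus with its normalised Haar
measure; the cube has volume one, so no constant appears. -/
theorem hasSum_sq_expo {f : E → ℝ} (hf : MemLp f 2 cellMeasure) :
    HasSum (fun k : Fin 3 → ℤ => ‖∫ y in cell, expo (-k) y * f y‖ ^ 2)
      (∫ y in cell, f y ^ 2) := by
  have hemb : MeasurableEmbedding torusRep := by
    refine MeasurableEmbedding.comp ?_ ((MeasurableEmbedding.subtype_coe
      (MeasurableSet.univ_pi' (fun i => measurableSet_Ioc))).comp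
      (UnitAddTorus.measurableEquivPiIoc (fun _ : Fin 3 => (0 : ℝ))).measurableEmbedding)
    exact (MeasurableEquiv.toLp 2 (Fin 3 → ℝ)).measurableEmbedding
  have hg : MemLp (fun t => (f (torusRep t) : ℂ)) 2 volume :=
    (hf.comp_measurePreserving measurePreserving_torusRep).ofReal
  have h := UnitAddTorus.hasSum_sq_mFourierCoeff (MemLp.toLp _ hg)
  have h1 : ∫ t, ‖MemLp.toLp _ hg t‖ ^ 2 = ∫ y in cell, f y ^ 2 := by
    rw [← measurePreserving_torusRep.integral_comp hemb (fun y => f y ^ 2)]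
    refine integral_congr_ae ?_
    filter_upwards [hg.coeFn_toLp] with t ht
    rw [ht]
    simp
  have h2 (k : Fin 3 → ℤ) : UnitAddTorus.mFourierCoeff (MemLp.toLp _ hg) k =
      ∫ y in cell, expo (-k) y * f y := by
    rw [← measurePreserving_torusRep.integral_comp hemb (fun y => expo (-k) y * f y)]
    refine integral_congr_ae ?_
    filter_upwards [hg.coeFn_toLp] with t ht
    rw [ht, expo_eq_mFourier, coe_torusRep, smul_eq_mul]
  simpa only [h1, h2] using h

end Parseval

/-! ### Elementary properties of the exponentials -/

theorem norm_expo (k : Fin 3 → ℤ) (y : E) : ‖expo k y‖ = 1 := by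
  have : (2 * Real.pi * Complex.I * (∑ j, k j * y j : ℝ) : ℂ) =
      ((2 * Real.pi * ∑ j, k j * y j : ℝ) : ℂ) * Complex.I := by
    push_cast; ring
  rw [expo, this, Complex.norm_exp_ofReal_mul_I]

theorem conj_expo (k : Fin 3 → ℤ) (y : E) : (starRingEnd ℂ) (expo k y) = expo (-k) y := by
  rw [expo_eq_mFourier, expo_eq_mFourier, UnitAddTorus.mFourier_neg]

theorem expo_zero (y : E) : expo 0 y = 1 := by simp [expo]

theorem expo_add_latticeVec (k n : Fin 3 → ℤ) (y : E) : expo k (y + latticeVec n) = expo k y := by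
  simp only [expo_eq_mFourier]
  congr 1
  ext i
  simp [latticeVec]

@[fun_prop]
theorem continuous_expo (k : Fin 3 → ℤ) : Continuous (expo k) := by
  unfold expo
  fun_prop

@[fun_prop]
theorem contDiff_expo (k : Fin 3 → ℤ) : ContDiff ℝ ∞ (expo k) := by
  unfold expo
  have h : ContDiff ℝ ∞ fun y : E => ∑ j, (k j : ℝ) * y j := by fun_prop
  exact (contDiff_const.mul (Complex.ofRealCLM.contDiff.comp h)).cexp

/-! ### Real parts of vector-valued exponentials -/

/-- Three-dimensional complex Euclidean space. -/
abbrev C3 : Type := EuclideanSpace ℂ (Fin 3)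

/-- Square summable families of vectors in `ℂ³` indexed by `ℤ³`. -/
abbrev Seq : Type := lp (fun _ : Fin 3 → ℤ => C3) 2

instance : IsFiniteMeasure cellMeasure := ⟨by
  rw [Measure.restrict_apply_univ]
  refine lt_of_le_of_lt (measure_mono ?_) isCompact_closedCell.measure_lt_top
  exact fun y hy i => ⟨(hy i).1.le, (hy i).2.le⟩⟩

/-- The real part of a vector in `ℂ³`. -/
def reVec : C3 →L[ℝ] E :=
  LinearMap.mkContinuous
    { toFun := fun v => WithLp.toLp 2 fun i => (v i).re
      map_add' := fun v w => by ext i; simp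
      map_smul' := fun c v => by ext i; simp } 1 fun v => by
    rw [one_mul, EuclideanSpace.norm_eq, EuclideanSpace.norm_eq]
    refine Real.sqrt_le_sqrt (Finset.sum_le_sum fun i _ => ?_)
    have : ‖(v i).re‖ ≤ ‖v i‖ := Complex.abs_re_le_norm _
    simpa using pow_le_pow_left₀ (norm_nonneg _) this 2

@[simp]
theorem reVec_apply (v : C3) (i : Fin 3) : reVec v i = (v i).re := rfl

theorem norm_reVec_le (v : C3) : ‖reVec v‖ ≤ ‖v‖ := by
  simpa using (reVec.le_of_opNorm_le (LinearMap.mkContinuous_norm_le _ zero_le_one _) v)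

/-- The vector field `Re (exp (2πi k·y) v)`. -/
def mode (k : Fin 3 → ℤ) : C3 →L[ℝ] (E →ᵇ E) :=
  LinearMap.mkContinuous
    { toFun := fun v => BoundedContinuousFunction.ofNormedAddCommGroup
        (fun y => reVec (expo k y • v))
        (reVec.continuous.comp ((continuous_expo k).smul continuous_const)) ‖v‖ fun y => by
          refine (norm_reVec_le _).trans ?_
          rw [norm_smul, norm_expo, one_mul]
      map_add' := fun v w => by ext1 y; simp
      map_smul' := fun c v => by ext1 y; simp [smul_comm (expo k y) c] } 1 fun v => by
    rw [one_mul]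
    refine (BoundedContinuousFunction.norm_le (norm_nonneg v)).2 fun y => ?_
    refine (norm_reVec_le _).trans ?_
    rw [norm_smul, norm_expo, one_mul]

theorem mode_apply (k : Fin 3 → ℤ) (v : C3) (y : E) : mode k v y = reVec (expo k y • v) := rfl

theorem norm_mode_le (k : Fin 3 → ℤ) (v : C3) : ‖mode k v‖ ≤ ‖v‖ := by
  simpa using ((mode k).le_of_opNorm_le (LinearMap.mkContinuous_norm_le _ zero_le_one _) v)

theorem mode_add_latticeVec (k n : Fin 3 → ℤ) (v : C3) (y : E) :
    mode k v (y + latticeVec n) = mode k v y := by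
  rw [mode_apply, mode_apply, expo_add_latticeVec]

theorem contDiff_mode (k : Fin 3 → ℤ) (v : C3) : ContDiff ℝ ∞ (mode k v) :=
  reVec.contDiff.comp ((contDiff_expo k).smul contDiff_const)

/-! ### Fourier coefficients and synthesis -/

/-- The class in `L²(Y)³` of a bounded continuous vector field. -/
def toL2 : (E →ᵇ E) →L[ℝ] L2Cell := BoundedContinuousFunction.toLp 2 cellMeasure ℝ

theorem coeFn_toL2 (f : E →ᵇ E) : toL2 f =ᵐ[cellMeasure] f :=
  BoundedContinuousFunction.coeFn_toLp 2 cellMeasure ℝ f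

/-- The Fourier coefficient of a vector field in `L²(Y)³`. -/
def coef (k : Fin 3 → ℤ) : L2Cell →L[ℝ] C3 := ContinuousLinearMap.adjoint (toL2.comp (mode k))

theorem inner_coef (k : Fin 3 → ℤ) (u : L2Cell) (v : C3) :
    ⟪coef k u, v⟫ = ⟪u, toL2 (mode k v)⟫ := ContinuousLinearMap.adjoint_inner_left _ _ _

theorem inner_toL2 (u : L2Cell) (f : E →ᵇ E) : ⟪u, toL2 f⟫ = ∫ y in cell, ⟪u y, f y⟫ := by
  rw [L2.inner_def]
  refine integral_congr_ae ?_
  filter_upwards [coeFn_toL2 f] with y hy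
  rw [hy]

theorem inner_toL2_left (u : L2Cell) (f : E →ᵇ E) : ⟪toL2 f, u⟫ = ∫ y in cell, ⟪f y, u y⟫ := by
  rw [L2.inner_def]
  refine integral_congr_ae ?_
  filter_upwards [coeFn_toL2 f] with y hy
  rw [hy]

theorem integrable_expo_mul (k : Fin 3 → ℤ) (u : L2Cell) (i : Fin 3) :
    Integrable (fun y => expo k y * u y i) cellMeasure := by
  have h : Integrable (fun y => (u y i : ℂ)) cellMeasure :=
    (((EuclideanSpace.proj (𝕜 := ℝ) i).comp_memLp u).integrable (by norm_num)).ofReal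
  refine h.bdd_mul (c := 1) (continuous_expo k).aestronglyMeasurable ?_
  exact Filter.Eventually.of_forall fun y => (norm_expo k y).le

/-- The abstract definition as an adjoint makes continuity and duality with `mode` immediate; this
identifies it with the classical coefficient so that Parseval applies. -/
theorem coef_apply (k : Fin 3 → ℤ) (u : L2Cell) (i : Fin 3) :
    coef k u i = ∫ y in cell, expo (-k) y * u y i := by
  suffices h : coef k u = WithLp.toLp 2 fun i => ∫ y in cell, expo (-k) y * u y i by rw [h]
  refine ext_inner_right ℝ fun v => ?_
  rw [inner_coef, inner_toL2]
  have h1 (y : E) : ⟪u y, mode k v y⟫ = (∑ i, (expo (-k) y * u y i) * (starRingEnd ℂ) (v i)).re := by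
    rw [PiLp.inner_apply, Complex.re_sum]
    refine Finset.sum_congr rfl fun i _ => ?_
    rw [← conj_expo, mode_apply]
    simp
    ring
  have h2 : ∀ i ∈ Finset.univ, Integrable (fun y => expo (-k) y * u y i * (starRingEnd ℂ) (v i))
      cellMeasure := fun i _ => (integrable_expo_mul (-k) u i).mul_const _
  simp_rw [h1]
  have h3 := integral_re (μ := cellMeasure) (𝕜 := ℂ) (integrable_finsetSum _ h2)
  simp only [RCLike.re_eq_complex_re] at h3
  rw [h3, integral_finsetSum _ h2, PiLp.inner_apply, Complex.re_sum]
  refine Finset.sum_congr rfl fun i _ => ?_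
  rw [integral_mul_const]
  simp
  ring

theorem hasSum_norm_coef_sq (u : L2Cell) : HasSum (fun k => ‖coef k u‖ ^ 2) (‖u‖ ^ 2) := by
  have h1 (i : Fin 3) : MemLp (fun y => u y i) 2 cellMeasure :=
    (EuclideanSpace.proj (𝕜 := ℝ) i).comp_memLp u
  have h := hasSum_sum (s := Finset.univ) fun i _ => hasSum_sq_expo (h1 i)
  have h2 : ∑ i, ∫ y in cell, u y i ^ 2 = ‖u‖ ^ 2 := by
    rw [← integral_finsetSum _ fun i _ => (h1 i).integrable_sq, ← real_inner_self_eq_norm_sq,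
      L2.inner_def]
    refine integral_congr_ae (Filter.Eventually.of_forall fun y => ?_)
    simp [EuclideanSpace.norm_sq_eq]
  rw [h2] at h
  convert h using 2 with k
  rw [EuclideanSpace.norm_sq_eq]
  exact Finset.sum_congr rfl fun i _ => by rw [coef_apply]

/-- The Fourier transform on `L²(Y)³`. -/
def fourierSeq : L2Cell →ₗᵢ[ℝ] Seq where
  toFun u := ⟨fun k => coef k u, memℓp_gen (by simpa using (hasSum_norm_coef_sq u).summable)⟩
  map_add' u v := by ext1; funext k; exact map_add (coef k) u v
  map_smul' c u := by ext1; funext k; exact map_smul (coef k) c u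
  norm_map' u := by
    have h := lp.norm_rpow_eq_tsum (p := 2) (by norm_num)
      (⟨fun k => coef k u, memℓp_gen (by simpa using (hasSum_norm_coef_sq u).summable)⟩ : Seq)
    have h2 := (hasSum_norm_coef_sq u).tsum_eq
    simp only [ENNReal.toReal_ofNat, Real.rpow_ofNat] at h
    rw [h2] at h
    exact (pow_left_inj₀ (norm_nonneg _) (norm_nonneg _) two_ne_zero).1 h

theorem fourierSeq_apply (u : L2Cell) (k : Fin 3 → ℤ) : fourierSeq u k = coef k u := rfl

/-- The vector field with the given Fourier coefficients. -/
def synth : Seq →L[ℝ] L2Cell := ContinuousLinearMap.adjoint fourierSeq.toContinuousLinearMap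

/-- The adjoint of an isometry is a left inverse. It is not a right inverse: `Seq` contains families
without the symmetry `c (-k) = conj (c k)` of real fields, and `synth` then keeps only their
symmetric part. For this reason later statements about `synth c` are proved on modes and summed, not
read off from `coef`. -/
theorem synth_fourierSeq (u : L2Cell) : synth (fourierSeq u) = u := by
  refine ext_inner_right ℝ fun v => ?_
  rw [synth, ContinuousLinearMap.adjoint_inner_left]
  exact fourierSeq.inner_map_map u v

theorem synth_single (k : Fin 3 → ℤ) (v : C3) : synth (lp.single 2 k v) = toL2 (mode k v) := by
  refine ext_inner_right ℝ fun w => ?_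
  rw [synth, ContinuousLinearMap.adjoint_inner_left, lp.inner_single_left]
  change ⟪v, coef k w⟫ = _
  rw [real_inner_comm, inner_coef, real_inner_comm]

theorem hasSum_synth (c : Seq) : HasSum (fun k => toL2 (mode k (c k))) (synth c) := by
  have h := synth.hasSum (lp.hasSum_single ENNReal.ofNat_ne_top c)
  simpa only [synth_single] using h

theorem hasSum_coef (u : L2Cell) : HasSum (fun k => toL2 (mode k (coef k u))) u := by
  have := hasSum_synth (fourierSeq u)
  rwa [synth_fourierSeq] at this

/-- The diagonal operator on `ℓ²` given by a bounded multiplier. -/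
def diag (m : (Fin 3 → ℤ) → C3 →L[ℝ] C3) (C : ℝ) (hm : ∀ k v, ‖m k v‖ ≤ C * ‖v‖) : Seq →L[ℝ] Seq :=
  have hC (c : Seq) : Summable fun k => (C * ‖c k‖) ^ 2 := by
    simp_rw [mul_pow]
    exact Summable.mul_left _ (by simpa using (lp.memℓp c).summable (by norm_num))
  have hs (c : Seq) : Summable fun k => ‖m k (c k)‖ ^ 2 :=
    (hC c).of_nonneg_of_le (fun k => by positivity) fun k =>
      pow_le_pow_left₀ (norm_nonneg _) (hm k _) 2
  LinearMap.mkContinuous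
    { toFun := fun c => ⟨fun k => m k (c k), memℓp_gen (by simpa using hs c)⟩
      map_add' := fun c d => by ext1; funext k; exact map_add (m k) _ _
      map_smul' := fun r c => by ext1; funext k; exact map_smul (m k) _ _ } |C| fun c => by
    have h := lp.norm_rpow_eq_tsum (p := 2) (by norm_num)
      (⟨fun k => m k (c k), memℓp_gen (by simpa using hs c)⟩ : Seq)
    have h2 := lp.norm_rpow_eq_tsum (p := 2) (by norm_num) c
    simp only [ENNReal.toReal_ofNat, Real.rpow_ofNat] at h h2
    refine (pow_le_pow_iff_left₀ (norm_nonneg _) (by positivity) two_ne_zero).1 ?_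
    refine h.trans_le ?_
    rw [mul_pow, h2, sq_abs, ← tsum_mul_left]
    refine (hs c).tsum_le_tsum (fun k => ?_) (by simpa only [mul_pow] using hC c)
    rw [← mul_pow]
    exact pow_le_pow_left₀ (norm_nonneg _) (hm k _) 2

/-! ### Unfolding integrals of periodic functions -/

/-- Periodicity with respect to the lattice `ℤ³`. -/
def IsPer {F : Type*} (f : E → F) : Prop := ∀ (n : Fin 3 → ℤ) (y : E), f (y + latticeVec n) = f y

theorem isPer_of_unit {F : Type*} {f : E → F} (h : ∀ i y, f (y + e i) = f y) : IsPer f := by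
  have h1 (i : Fin 3) (m : ℤ) (y : E) : f (y + m • e i) = f y := by
    have hp : Function.Periodic f (e i) := fun y => h i y
    exact hp.zsmul m y
  intro n y
  have : latticeVec n = n 0 • e 0 + n 1 • e 1 + n 2 • e 2 := by
    ext j
    fin_cases j <;> simp [latticeVec, e]
  rw [this, ← add_assoc, ← add_assoc, h1, h1, h1]

theorem IsPer.cellFract {F : Type*} {f : E → F} (h : IsPer f) (y : E) : f (cellFract y) = f y := by
  rw [cellFract_eq, ← h (fun i => ⌊y i⌋), sub_add_cancel]

theorem IsPer.perExt {f : E → E} (h : IsPer f) : perExt f = f := funext fun y => h.cellFract y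

theorem cellFract_add_latticeVec (n : Fin 3 → ℤ) (y : E) :
    cellFract (y + latticeVec n) = cellFract y := by
  ext i; simp [CurlCell.cellFract, latticeVec]

theorem isPer_perExt (u : E → E) : IsPer (perExt u) := fun n y => by
  simp only [CurlCell.perExt, cellFract_add_latticeVec]

theorem cellFract_of_mem_cell {y : E} (hy : y ∈ cell) : CurlCell.cellFract y = y := by
  have h0 : latticeVec 0 = 0 := by ext i; simp [latticeVec]
  simpa [h0] using cellFract_of_sub_mem (y := y) (k := 0) (by simpa [h0] using hy)

/-- The shifts of the unit cube that cover the cube `(-1, 1)³`. -/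
def shifts : Finset (Fin 3 → ℤ) := Fintype.piFinset fun _ => {-1, 0}

/-- The lattice translates of the open cube are disjoint and cover space up to a null set; `s` lists
those that can meet the support of `G`. -/
theorem integral_eq_sum_cell {G : E → ℝ} (s : Finset (Fin 3 → ℤ))
    (hs : ∀ y, cellFract y ∈ cell → G y ≠ 0 → (fun i => ⌊y i⌋) ∈ s)
    (hint : ∀ n, IntegrableOn (fun y => G (y + latticeVec n)) cell) :
    ∫ y, G y = ∑ n ∈ s, ∫ y in cell, G (y + latticeVec n) := by
  have hmp (n : Fin 3 → ℤ) := measurePreserving_sub_right (volume : Measure E) (latticeVec n)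
  have hme (n : Fin 3 → ℤ) := measurableEmbedding_subRight (G := E) (latticeVec n)
  let A (n : Fin 3 → ℤ) : Set E := (fun y : E => y - latticeVec n) ⁻¹' cell
  have hA (n : Fin 3 → ℤ) : MeasurableSet (A n) :=
    measurableSet_cell.preimage (measurable_sub_const _)
  have h1 : ∫ y, G y = ∫ y in ⋃ n ∈ s, A n, G y := by
    symm
    refine setIntegral_eq_integral_of_ae_compl_eq_zero ?_
    filter_upwards [ae_cellFract_mem] with y hy hyA
    by_contra h0
    refine hyA (mem_iUnion₂.2 ⟨fun i => ⌊y i⌋, hs y hy h0, ?_⟩)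
    rw [cellFract_eq] at hy
    exact hy
  have hdisj : Pairwise (Function.onFun Disjoint A) := by
    intro m n hmn
    refine Set.disjoint_left.2 fun y hm hn => hmn ?_
    have h2 := (cellFract_of_sub_mem hm).symm.trans (cellFract_of_sub_mem hn)
    funext i
    have := congrArg (fun z : E => z i) h2
    simpa [latticeVec] using this
  have hshift (n : Fin 3 → ℤ) : G =
      (fun y => G (y + latticeVec n)) ∘ fun y => y - latticeVec n := by
    funext y
    simp only [Function.comp_apply, sub_add_cancel]
  rw [h1, integral_biUnion_finset _ (fun n _ => hA n) (fun m _ n _ h => hdisj h)]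
  · refine Finset.sum_congr rfl fun n _ => ?_
    conv_lhs => rw [hshift n]
    exact (hmp n).setIntegral_preimage_emb (hme n) (fun y => G (y + latticeVec n)) cell
  · intro n _
    rw [hshift n]
    exact ((hmp n).integrableOn_comp_preimage (hme n)).2 (hint n)

/-- Unfolding turns an integral over space into one over the cell in which only the sum of the
translates of `θ` matters. It is used with `c = 1` for `cutoff` and with `c = 0` for its
derivatives. -/
theorem integral_mul_of_isPer {g θ : E → ℝ} (hg : IsPer g) (hgi : IntegrableOn g cell)
    (hθ : Continuous θ) (hc : HasCompactSupport θ)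
    (hs : ∀ y, θ y ≠ 0 → ∀ i, -1 ≤ y i ∧ y i ≤ 1) (c : ℝ)
    (hsum : ∀ y ∈ cell, ∑ n ∈ shifts, θ (y + latticeVec n) = c) :
    ∫ y, θ y * g y = c * ∫ y in cell, g y := by
  obtain ⟨C, hC⟩ := hc.exists_bound_of_continuous hθ
  have hint (n : Fin 3 → ℤ) :
      IntegrableOn (fun y => θ (y + latticeVec n) * g (y + latticeVec n)) cell := by
    simp only [hg n]
    refine Integrable.bdd_mul (c := C) hgi
      (hθ.comp (continuous_add_const _)).aestronglyMeasurable ?_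
    exact Filter.Eventually.of_forall fun y => hC _
  rw [integral_eq_sum_cell shifts _ hint]
  · rw [← integral_finsetSum _ fun n _ => hint n, ← integral_const_mul]
    refine setIntegral_congr_fun measurableSet_cell fun y hy => ?_
    simp only [hg _ y]
    rw [← Finset.sum_mul, hsum y hy]
  · intro y hy h0
    rw [shifts, Fintype.mem_piFinset]
    intro i
    obtain ⟨ha, hb⟩ := hs y (left_ne_zero_of_mul h0) i
    have h3 : -1 ≤ ⌊y i⌋ := Int.le_floor.2 (by simpa using ha)
    have h4 : ⌊y i⌋ < 1 := by
      -- The value `y i = 1` would have floor `1`, outside `shifts`; it is excluded because its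
      -- fractional part is not in the open interval.
      refine Int.floor_lt.2 (lt_of_le_of_ne (by simpa using hb) fun h5 => ?_)
      have := (hy i).1
      simp [CurlCell.cellFract, h5] at this
    simp only [Finset.mem_insert, Finset.mem_singleton]
    omega

/-! ### A smooth lattice partition of unity -/

/-- A smooth function on the line, supported in `[-1, 1]`, whose integer translates sum to `1`. -/
def bump (t : ℝ) : ℝ := Real.smoothTransition (t + 1) - Real.smoothTransition t

theorem contDiff_bump : ContDiff ℝ ∞ bump :=
  (Real.smoothTransition.contDiff.comp (contDiff_id.add contDiff_const)).sub
    Real.smoothTransition.contDiff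

theorem bump_eq_zero {t : ℝ} (h : ¬ (-1 ≤ t ∧ t ≤ 1)) : bump t = 0 := by
  rw [not_and_or, not_le, not_le] at h
  rcases h with h | h
  · rw [bump, Real.smoothTransition.zero_of_nonpos (by linarith),
      Real.smoothTransition.zero_of_nonpos (by linarith), sub_zero]
  · rw [bump, Real.smoothTransition.one_of_one_le (by linarith),
      Real.smoothTransition.one_of_one_le h.le, sub_self]

/-- The sum telescopes to `smoothTransition (t + 1) - smoothTransition (t - 1)`, that is `1 - 0`. -/
theorem bump_sum {t : ℝ} (h : t ∈ Ioo (0 : ℝ) 1) :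
    ∑ a ∈ ({-1, 0} : Finset ℤ), bump (t + a) = 1 := by
  rw [Finset.sum_pair (by norm_num)]
  have h1 : Real.smoothTransition (t - 1) = 0 :=
    Real.smoothTransition.zero_of_nonpos (by linarith [h.2])
  have h2 : Real.smoothTransition (t + 1) = 1 :=
    Real.smoothTransition.one_of_one_le (by linarith [h.1])
  simp [bump, ← sub_eq_add_neg, h1, h2]

/-- A smooth function on `ℝ³`, supported in `[-1, 1]³`, whose lattice translates sum to `1`. -/
def cutoff (y : E) : ℝ := ∏ i, bump (y i)

theorem contDiff_cutoff : ContDiff ℝ ∞ cutoff := by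
  unfold cutoff
  refine contDiff_prod fun i _ => contDiff_bump.comp ?_
  exact (EuclideanSpace.proj (𝕜 := ℝ) i).contDiff

theorem isClosed_box : IsClosed {y : E | ∀ i, -1 ≤ y i ∧ y i ≤ 1} := by
  simp only [ofPred_forall]
  refine isClosed_iInter fun i => ?_
  exact (isClosed_le continuous_const (EuclideanSpace.proj (𝕜 := ℝ) i).continuous).inter
    (isClosed_le (EuclideanSpace.proj (𝕜 := ℝ) i).continuous continuous_const)

theorem tsupport_cutoff : tsupport cutoff ⊆ {y : E | ∀ i, -1 ≤ y i ∧ y i ≤ 1} := by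
  refine closure_minimal (fun y hy i => ?_) isClosed_box
  by_contra h
  exact hy (Finset.prod_eq_zero (Finset.mem_univ i) (bump_eq_zero h))

theorem hasCompactSupport_cutoff : HasCompactSupport cutoff := by
  refine (Metric.isCompact_of_isClosed_isBounded isClosed_box ?_).of_isClosed_subset
    (isClosed_tsupport _) tsupport_cutoff
  refine (Metric.isBounded_closedBall (x := (0 : E)) (r := 3)).subset fun y hy => ?_
  rw [mem_closedBall_zero_iff]
  have h3 := EuclideanSpace.norm_sq_eq y
  rw [Fin.sum_univ_three] at h3
  have h4 (i : Fin 3) : ‖y i‖ ^ 2 ≤ 1 := by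
    rw [sq_le_one_iff_abs_le_one, abs_norm, Real.norm_eq_abs, abs_le]
    exact hy i
  nlinarith [h4 0, h4 1, h4 2, norm_nonneg y]

theorem sum_cutoff {y : E} (hy : y ∈ cell) : ∑ n ∈ shifts, cutoff (y + latticeVec n) = 1 := by
  have h : ∏ i, ∑ a ∈ ({-1, 0} : Finset ℤ), bump (y i + a) = 1 :=
    Finset.prod_eq_one fun i _ => bump_sum (hy i)
  rw [Finset.prod_univ_sum] at h
  exact h

theorem isOpen_cell : IsOpen cell := by
  simp only [cell, ofPred_forall]
  exact isOpen_iInter_of_finite fun i =>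
    isOpen_Ioo.preimage (EuclideanSpace.proj (𝕜 := ℝ) i).continuous

theorem sum_fderiv_cutoff {y : E} (hy : y ∈ cell) (v : E) :
    ∑ n ∈ shifts, fderiv ℝ cutoff (y + latticeVec n) v = 0 := by
  have h1 : HasFDerivAt (fun z => ∑ n ∈ shifts, cutoff (z + latticeVec n))
      (∑ n ∈ shifts, fderiv ℝ cutoff (y + latticeVec n)) y := by
    refine HasFDerivAt.fun_sum fun n _ => ?_
    have := (contDiff_cutoff.differentiable (by simp) (y + latticeVec n)).hasFDerivAt
    exact this.comp y ((hasFDerivAt_id y).add_const (latticeVec n))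
  have h2 : HasFDerivAt (fun z => ∑ n ∈ shifts, cutoff (z + latticeVec n)) (0 : E →L[ℝ] ℝ) y := by
    refine (hasFDerivAt_const (1 : ℝ) y).congr_of_eventuallyEq ?_
    filter_upwards [isOpen_cell.mem_nhds hy] with z hz using sum_cutoff hz
  have h3 := congrArg (fun T : E →L[ℝ] ℝ => T v) (h1.unique h2)
  simpa using h3

theorem continuous_fderiv_cutoff (v : E) : Continuous fun y => fderiv ℝ cutoff y v :=
  continuous_fderiv_dir contDiff_cutoff v

theorem hasCompactSupport_fderiv_cutoff (v : E) : HasCompactSupport fun y => fderiv ℝ cutoff y v :=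
  hasCompactSupport_cutoff.fderiv_apply ℝ v

theorem integral_cutoff_mul {g : E → ℝ} (hg : IsPer g) (hgi : IntegrableOn g cell) :
    ∫ y, cutoff y * g y = ∫ y in cell, g y := by
  rw [integral_mul_of_isPer hg hgi contDiff_cutoff.continuous hasCompactSupport_cutoff
    (fun y hy => tsupport_cutoff (subset_tsupport _ hy)) 1 (fun y hy => sum_cutoff hy), one_mul]

theorem integral_fderiv_cutoff_mul {g : E → ℝ} (hg : IsPer g) (hgi : IntegrableOn g cell) (v : E) :
    ∫ y, fderiv ℝ cutoff y v * g y = 0 := by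
  rw [integral_mul_of_isPer hg hgi (continuous_fderiv_cutoff v)
    (hasCompactSupport_fderiv_cutoff v) (fun y hy => ?_) 0
    (fun y hy => sum_fderiv_cutoff hy v), zero_mul]
  refine tsupport_cutoff (tsupport_fderiv_subset ℝ (subset_tsupport _ fun h0 => hy ?_))
  rw [h0]
  rfl

theorem cell_subset_closedCell : cell ⊆ closedCell := fun _ hy i => ⟨(hy i).1.le, (hy i).2.le⟩

theorem integrableOn_cell {F : Type*} [NormedAddCommGroup F] {f : E → F} (hf : Continuous f) :
    IntegrableOn f cell :=
  (hf.continuousOn.integrableOn_compact isCompact_closedCell).mono_set cell_subset_closedCell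

theorem hasLineDerivAt_isPer {f f' : E → ℝ} {v : E} (hf : ∀ y, HasLineDerivAt ℝ f (f' y) y v)
    (hp : IsPer f) : IsPer f' := fun n y => by
  refine (hf (y + latticeVec n)).unique (HasDerivAt.congr_of_eventuallyEq (hf y)
    (Filter.Eventually.of_forall fun t => ?_))
  simp only
  rw [add_right_comm, hp]

/-- The integral over a period of a derivative of a periodic function vanishes. -/
theorem integral_cell_deriv_eq_zero {f f' : E → ℝ} {v : E} (hfc : Continuous f)
    (hfc' : Continuous f') (hf : ∀ y, HasLineDerivAt ℝ f (f' y) y v) (hp : IsPer f) :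
    ∫ y in cell, f' y = 0 := by
  rw [← integral_cutoff_mul (hasLineDerivAt_isPer hf hp) (integrableOn_cell hfc')]
  -- Integration by parts on the whole space against `cutoff` replaces a computation on the faces of
  -- the cube; the derivative of `cutoff` integrates to zero against periodic functions.
  have h := integral_bilinear_hasLineDerivAt_right_eq_neg_left_of_integrable
    (μ := (volume : Measure E)) (B := ContinuousLinearMap.mul ℝ ℝ) (f := cutoff)
    (f' := fun y => fderiv ℝ cutoff y v) (g := f) (g' := f') (v := v)
    (((continuous_fderiv_cutoff v).mul hfc).integrable_of_hasCompactSupport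
      (hasCompactSupport_fderiv_cutoff v).mul_right)
    ((contDiff_cutoff.continuous.mul hfc').integrable_of_hasCompactSupport
      hasCompactSupport_cutoff.mul_right)
    ((contDiff_cutoff.continuous.mul hfc).integrable_of_hasCompactSupport
      hasCompactSupport_cutoff.mul_right)
    (fun y _ => (contDiff_cutoff.differentiable (by simp) y).hasFDerivAt.hasLineDerivAt v)
    (fun y _ => hf y)
  simp only [ContinuousLinearMap.mul_apply'] at h
  rw [h, integral_fderiv_cutoff_mul hp (integrableOn_cell hfc), neg_zero]

/-! ### Periodic continuously differentiable fields and their Fourier coefficients -/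

/-- `f` is periodic and has the continuous bounded partial derivatives `f'`. -/
structure IsC1Per {F : Type*} [NormedAddCommGroup F] [NormedSpace ℝ F] (f : E →ᵇ F)
    (f' : Fin 3 → E →ᵇ F) : Prop where
  deriv : ∀ i y, HasLineDerivAt ℝ f (f' i y) y (e i)
  per : IsPer f

/-- The complex number `2πi k_j`. -/
def freq (k : Fin 3 → ℤ) (j : Fin 3) : ℂ := 2 * Real.pi * Complex.I * k j

theorem conj_freq (k : Fin 3 → ℤ) (j : Fin 3) : (starRingEnd ℂ) (freq k j) = -freq k j := by
  simp [freq, mul_assoc, map_ofNat]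

theorem hasLineDerivAt_expo (k : Fin 3 → ℤ) (j : Fin 3) (y : E) :
    HasLineDerivAt ℝ (expo k) (freq k j * expo k y) y (e j) := by
  have h1 (t : ℝ) : ∑ i, (k i : ℝ) * (y + t • e j) i = (∑ i, k i * y i) + t * k j := by
    have : ∑ i, (k i : ℝ) * (t * (e j) i) = t * k j := by
      rw [Finset.sum_eq_single j]
      · simp [e]; ring
      · intro b _ hb; simp [e, hb]
      · simp
    simp [mul_add, Finset.sum_add_distrib, this]
  have h2 : HasDerivAt (fun t : ℝ => 2 * Real.pi * Complex.I *
      (((∑ i, k i * y i) + t * k j : ℝ) : ℂ)) (freq k j) 0 := by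
    have h3 : HasDerivAt (fun t : ℝ => (((∑ i, k i * y i) + t * k j : ℝ) : ℂ)) (k j : ℂ) 0 := by
      have := ((hasDerivAt_id (0 : ℝ)).mul_const (k j : ℝ)).const_add (∑ i, k i * y i)
      simpa using this.ofReal_comp
    exact h3.const_mul _
  have h3 := h2.cexp
  simp only [← h1] at h3
  refine (HasDerivAt.congr_deriv h3 ?_ :)
  rw [h1, zero_mul, add_zero, mul_comm]
  rfl

theorem hasLineDerivAt_mode (k : Fin 3 → ℤ) (v : C3) (j : Fin 3) (y : E) :
    HasLineDerivAt ℝ (mode k v) (mode k (freq k j • v) y) y (e j) := by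
  have h := reVec.hasFDerivAt.comp_hasDerivAt (0 : ℝ)
    (HasDerivAt.smul_const (hasLineDerivAt_expo k j y) v)
  refine (HasDerivAt.congr_deriv h ?_ :)
  rw [mode_apply, smul_smul, mul_comm (expo k y)]

theorem isC1Per_mode (k : Fin 3 → ℤ) (v : C3) :
    IsC1Per (mode k v) (fun j => mode k (freq k j • v)) :=
  ⟨fun j y => hasLineDerivAt_mode k v j y, fun n y => mode_add_latticeVec k n v y⟩

theorem inner_smul_C3 (z : ℂ) (u v : C3) : ⟪z • u, v⟫ = ⟪u, (starRingEnd ℂ) z • v⟫ := by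
  simp only [PiLp.inner_apply]
  refine Finset.sum_congr rfl fun i _ => ?_
  simp
  ring

theorem coef_deriv {f : E →ᵇ E} {f' : Fin 3 → E →ᵇ E} (h : IsC1Per f f') (k : Fin 3 → ℤ)
    (j : Fin 3) : coef k (toL2 (f' j)) = freq k j • coef k (toL2 f) := by
  refine ext_inner_right ℝ fun v => ?_
  rw [inner_smul_C3, inner_coef, inner_coef, conj_freq, neg_smul, map_neg, map_neg, inner_neg_right,
    inner_toL2_left, inner_toL2_left, eq_neg_iff_add_eq_zero]
  have hc1 : Continuous fun y => ⟪f y, mode k (freq k j • v) y⟫ :=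
    f.continuous.inner (mode k _).continuous
  have hc2 : Continuous fun y => ⟪f' j y, mode k v y⟫ := (f' j).continuous.inner (mode k _).continuous
  have hd (g : E →ᵇ E) (l : C3) : ∫ y in cell, ⟪g y, toL2 (mode k l) y⟫ =
      ∫ y in cell, ⟪g y, mode k l y⟫ := by
    refine integral_congr_ae ?_
    filter_upwards [coeFn_toL2 (mode k l)] with y hy
    rw [hy]
  rw [hd, hd, ← integral_add (integrableOn_cell hc2) (integrableOn_cell hc1)]
  refine integral_cell_deriv_eq_zero (f := fun y => ⟪f y, mode k v y⟫) (v := e j)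
    (f.continuous.inner (mode k _).continuous) (hc2.add hc1) (fun y => ?_) fun n y => ?_
  · have := HasDerivAt.inner ℝ (h.deriv j y) (hasLineDerivAt_mode k v j y)
    simp only [zero_smul, add_zero] at this
    rw [add_comm] at this
    exact this
  · simp only [h.per n y, mode_add_latticeVec]

/-! ### Multiplication operators and periodic weak derivatives -/

/-- Multiplication of a field in `L²(Y)³` by a bounded continuous function. -/
def mulL : (E →ᵇ ℝ) →L[ℝ] L2Cell →L[ℝ] L2Cell :=
  ((ContinuousLinearMap.lsmul ℝ ℝ).holderL cellMeasure ∞ 2 2).comp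
    (BoundedContinuousFunction.toLp ∞ cellMeasure ℝ)

theorem coeFn_mulL (b : E →ᵇ ℝ) (u : L2Cell) :
    mulL b u =ᵐ[cellMeasure] fun y => b y • u y := by
  have h1 := (ContinuousLinearMap.lsmul ℝ ℝ : ℝ →L[ℝ] E →L[ℝ] E).coeFn_holder (r := 2)
    (BoundedContinuousFunction.toLp ∞ cellMeasure ℝ b) u
  filter_upwards [h1, BoundedContinuousFunction.coeFn_toLp ∞ cellMeasure ℝ b] with y h1 h2
  rw [h2] at h1
  exact h1

theorem mulL_toL2 (b : E →ᵇ ℝ) (f : E →ᵇ E) : mulL b (toL2 f) = toL2 (b • f) := by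
  refine Lp.ext ?_
  filter_upwards [coeFn_mulL b (toL2 f), coeFn_toL2 f, coeFn_toL2 (b • f)] with y h1 h2 h3
  rw [h1, h2, h3]
  rfl

theorem mulL_mul (a b : E →ᵇ ℝ) (u : L2Cell) : mulL (a * b) u = mulL a (mulL b u) := by
  refine Lp.ext ?_
  filter_upwards [coeFn_mulL (a * b) u, coeFn_mulL b u, coeFn_mulL a (mulL b u)] with y h1 h2 h3
  rw [h1, h3, h2, smul_smul]
  rfl

theorem mulL_one (u : L2Cell) : mulL 1 u = u := by
  refine Lp.ext ?_
  filter_upwards [coeFn_mulL 1 u] with y h1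
  rw [h1]
  simp

theorem inner_mulL (b : E →ᵇ ℝ) (u v : L2Cell) : ⟪mulL b u, v⟫ = ⟪u, mulL b v⟫ := by
  rw [L2.inner_def, L2.inner_def]
  refine integral_congr_ae ?_
  filter_upwards [coeFn_mulL b u, coeFn_mulL b v] with y h1 h2
  rw [h1, h2, real_inner_smul_left, real_inner_smul_right]

theorem IsC1Per.smul {b : E →ᵇ ℝ} {b' : Fin 3 → E →ᵇ ℝ} (hb : IsC1Per b b') {f : E →ᵇ E}
    {f' : Fin 3 → E →ᵇ E} (hf : IsC1Per f f') :
    IsC1Per (b • f) (fun i => b' i • f + b • f' i) where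
  deriv i y := by
    have := HasDerivAt.smul (hb.deriv i y) (hf.deriv i y)
    simp only [zero_smul, add_zero] at this
    rw [add_comm] at this
    exact this
  per n y := by
    change b (y + latticeVec n) • f (y + latticeVec n) = b y • f y
    rw [hb.per n y, hf.per n y]

/-- The periodic weak partial derivative of `u` in the direction `e j` is `w`. -/
def HasPartial (j : Fin 3) (u w : L2Cell) : Prop := ∀ k, coef k w = freq k j • coef k u

theorem IsC1Per.hasPartial {f : E →ᵇ E} {f' : Fin 3 → E →ᵇ E} (h : IsC1Per f f') (j : Fin 3) :
    HasPartial j (toL2 f) (toL2 (f' j)) := fun k => coef_deriv h k j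

/-- The weak derivative is a closed operator, since each `coef k` is continuous. This reduces
differentiation rules to smooth modes. -/
theorem hasPartial_of_hasSum {ι : Type*} {j : Fin 3} {u w : ι → L2Cell} {u₀ w₀ : L2Cell}
    (h : ∀ n, HasPartial j (u n) (w n)) (hu : HasSum u u₀) (hw : HasSum w w₀) :
    HasPartial j u₀ w₀ := by
  intro k
  have h1 := (coef k).hasSum hw
  have h2 := ((coef k).hasSum hu).const_smul (freq k j)
  refine h1.unique (h2.congr_fun fun n => ?_)
  exact h n k

theorem hasPartial_synth {j : Fin 3} {c d : Seq} (h : ∀ k, d k = freq k j • c k) :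
    HasPartial j (synth c) (synth d) := by
  refine hasPartial_of_hasSum (fun k => ?_) (hasSum_synth c) (hasSum_synth d)
  rw [h k]
  exact (isC1Per_mode k (c k)).hasPartial j

theorem HasPartial.hasSum {j : Fin 3} {u w : L2Cell} (h : HasPartial j u w) :
    HasSum (fun k => toL2 (mode k (freq k j • coef k u))) w := by
  have := hasSum_coef w
  simp_rw [h _] at this
  exact this

theorem HasPartial.add {j : Fin 3} {u w u' w' : L2Cell} (h : HasPartial j u w)
    (h' : HasPartial j u' w') : HasPartial j (u + u') (w + w') := fun k => by
  rw [map_add, map_add, h k, h' k, smul_add]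

theorem HasPartial.sum {ι : Type*} {s : Finset ι} {j : Fin 3} {u w : ι → L2Cell}
    (h : ∀ n ∈ s, HasPartial j (u n) (w n)) : HasPartial j (∑ n ∈ s, u n) (∑ n ∈ s, w n) :=
  fun k => by
    rw [map_sum, map_sum, Finset.smul_sum]
    exact Finset.sum_congr rfl fun n hn => h n hn k

/-- Leibniz rule: it is classical for `b` times a single mode, and the expansion of `u` into modes
carries it over by closedness. -/
theorem HasPartial.mulL {b : E →ᵇ ℝ} {b' : Fin 3 → E →ᵇ ℝ} (hb : IsC1Per b b') {j : Fin 3}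
    {u w : L2Cell} (h : HasPartial j u w) :
    HasPartial j (mulL b u) (CurlCell.mulL (b' j) u + CurlCell.mulL b w) := by
  refine hasPartial_of_hasSum (fun k => ?_) ((CurlCell.mulL b).hasSum (hasSum_coef u))
    (((CurlCell.mulL (b' j)).hasSum (hasSum_coef u)).add ((CurlCell.mulL b).hasSum h.hasSum))
  rw [mulL_toL2, mulL_toL2, mulL_toL2, ← map_add]
  exact (hb.smul (isC1Per_mode k (coef k u))).hasPartial j

/-! ### Cross products -/

/-- The cross product with a fixed vector in `ℝ³`. -/
def crossE (w : Fin 3 → ℝ) : E →L[ℝ] E :=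
  LinearMap.toContinuousLinearMap
    { toFun := fun v => !₂[w 1 * v 2 - w 2 * v 1, w 2 * v 0 - w 0 * v 2, w 0 * v 1 - w 1 * v 0]
      map_add' := fun u v => by ext i; fin_cases i <;> simp <;> ring
      map_smul' := fun c v => by ext i; fin_cases i <;> simp <;> ring }

theorem crossE_apply (w : Fin 3 → ℝ) (v : E) : crossE w v =
    !₂[w 1 * v 2 - w 2 * v 1, w 2 * v 0 - w 0 * v 2, w 0 * v 1 - w 1 * v 0] := rfl

/-- The cross product with a fixed vector in `ℂ³`. -/
def crossC (w : Fin 3 → ℂ) : C3 →L[ℝ] C3 :=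
  LinearMap.toContinuousLinearMap
    { toFun := fun v => !₂[w 1 * v 2 - w 2 * v 1, w 2 * v 0 - w 0 * v 2, w 0 * v 1 - w 1 * v 0]
      map_add' := fun u v => by ext i; fin_cases i <;> simp <;> ring
      map_smul' := fun c v => by ext i; fin_cases i <;> simp <;> ring }

theorem crossC_apply (w : Fin 3 → ℂ) (v : C3) : crossC w v =
    !₂[w 1 * v 2 - w 2 * v 1, w 2 * v 0 - w 0 * v 2, w 0 * v 1 - w 1 * v 0] := rfl

theorem crossC_smul (w : Fin 3 → ℂ) (z : ℂ) (v : C3) : crossC w (z • v) = z • crossC w v := by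
  ext i
  fin_cases i <;> simp [crossC_apply] <;> ring

theorem crossC_smul_left (w : Fin 3 → ℂ) (z : ℂ) (v : C3) : crossC (z • w) v = z • crossC w v := by
  ext i
  fin_cases i <;> simp [crossC_apply] <;> ring

/-- Each component is at most `2 * C * ‖v‖`; the constant `6` is generous, as only boundedness
matters. -/
theorem norm_crossC_le {w : Fin 3 → ℂ} {C : ℝ} (hw : ∀ j, ‖w j‖ ≤ C) (v : C3) :
    ‖crossC w v‖ ≤ 6 * C * ‖v‖ := by
  have hC : 0 ≤ C := (norm_nonneg _).trans (hw 0)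
  have h2 (i j k l : Fin 3) : ‖w i * v j - w k * v l‖ ≤ 2 * C * ‖v‖ := by
    refine (norm_sub_le _ _).trans ?_
    rw [norm_mul, norm_mul]
    have h3 := mul_le_mul (hw i) (PiLp.norm_apply_le v j) (norm_nonneg _) hC
    have h4 := mul_le_mul (hw k) (PiLp.norm_apply_le v l) (norm_nonneg _) hC
    linarith
  refine (pow_le_pow_iff_left₀ (norm_nonneg _) (by positivity) two_ne_zero).1 ?_
  rw [EuclideanSpace.norm_sq_eq, Fin.sum_univ_three]
  have h5 (i j k l : Fin 3) := pow_le_pow_left₀ (norm_nonneg _) (h2 i j k l) 2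
  have a0 := h5 1 2 2 1
  have a1 := h5 2 0 0 2
  have a2 := h5 0 1 1 0
  simp only [crossC_apply, Fin.isValue]
  calc _ ≤ (2 * C * ‖v‖) ^ 2 + (2 * C * ‖v‖) ^ 2 + (2 * C * ‖v‖) ^ 2 :=
        add_le_add (add_le_add a0 a1) a2
    _ ≤ (6 * C * ‖v‖) ^ 2 := by nlinarith [mul_nonneg hC (norm_nonneg v)]

theorem reVec_crossC (w : Fin 3 → ℝ) (v : C3) :
    reVec (crossC (fun j => (w j : ℂ)) v) = crossE w (reVec v) := by
  ext i
  fin_cases i <;> simp [crossC_apply, crossE_apply]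

theorem inner_crossE (w : Fin 3 → ℝ) (u v : E) : ⟪crossE w u, v⟫ = -⟪u, crossE w v⟫ := by
  simp [PiLp.inner_apply, Fin.sum_univ_three, crossE_apply]
  ring

theorem inner_crossC (w : Fin 3 → ℂ) (u v : C3) :
    ⟪crossC w u, v⟫ = -⟪u, crossC (fun j => (starRingEnd ℂ) (w j)) v⟫ := by
  simp [PiLp.inner_apply, Fin.sum_univ_three, crossC_apply]
  ring

/-- The pointwise cross product of a fixed vector with a field in `L²(Y)³`. -/
def crossL (w : Fin 3 → ℝ) : L2Cell →L[ℝ] L2Cell := (crossE w).compLpL 2 cellMeasure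

theorem coeFn_crossL (w : Fin 3 → ℝ) (u : L2Cell) :
    crossL w u =ᵐ[cellMeasure] fun y => crossE w (u y) := (crossE w).coeFn_compLpL u

theorem mode_crossC (k : Fin 3 → ℤ) (w : Fin 3 → ℝ) (v : C3) (y : E) :
    mode k (crossC (fun j => (w j : ℂ)) v) y = crossE w (mode k v y) := by
  rw [mode_apply, mode_apply, ← crossC_smul, reVec_crossC]

theorem inner_crossL (w : Fin 3 → ℝ) (u v : L2Cell) : ⟪crossL w u, v⟫ = -⟪u, crossL w v⟫ := by
  rw [L2.inner_def, L2.inner_def, ← integral_neg]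
  refine integral_congr_ae ?_
  filter_upwards [coeFn_crossL w u, coeFn_crossL w v] with y h1 h2
  rw [h1, h2, inner_crossE]

theorem crossL_toL2_mode (w : Fin 3 → ℝ) (k : Fin 3 → ℤ) (v : C3) :
    crossL w (toL2 (mode k v)) = toL2 (mode k (crossC (fun j => (w j : ℂ)) v)) := by
  refine Lp.ext ?_
  filter_upwards [coeFn_crossL w (toL2 (mode k v)), coeFn_toL2 (mode k v),
    coeFn_toL2 (mode k (crossC (fun j => (w j : ℂ)) v))] with y h1 h2 h3
  rw [h1, h2, h3, mode_crossC]

theorem coef_crossL (w : Fin 3 → ℝ) (k : Fin 3 → ℤ) (u : L2Cell) :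
    coef k (crossL w u) = crossC (fun j => (w j : ℂ)) (coef k u) := by
  refine ext_inner_right ℝ fun v => ?_
  rw [inner_coef, inner_crossL, crossL_toL2_mode, inner_crossC, inner_coef]
  simp

theorem HasPartial.crossL {j : Fin 3} {u w : L2Cell} (h : HasPartial j u w) (a : Fin 3 → ℝ) :
    HasPartial j (crossL a u) (CurlCell.crossL a w) := fun k => by
  rw [coef_crossL, coef_crossL, h k, crossC_smul]

/-! ### Weak derivatives of Fourier series -/

/-- A continuous function with compact support as a bounded continuous function. -/
def ofCompactSupport {F : Type*} [NormedAddCommGroup F] (ψ : E → F) (hψ : Continuous ψ)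
    (hc : HasCompactSupport ψ) : E →ᵇ F :=
  BoundedContinuousFunction.ofNormedAddCommGroup ψ hψ _
    (hc.exists_bound_of_continuous hψ).choose_spec

theorem integral_smul_mode (φ : E → ℝ) (hφ : ContDiff ℝ ∞ φ) (hc : HasCompactSupport φ)
    (hs : tsupport φ ⊆ cell) (j : Fin 3) (k : Fin 3 → ℤ) (v : C3) :
    ∫ y in cell, (fderiv ℝ φ y (e j)) • mode k v y =
      - ∫ y in cell, φ y • mode k (freq k j • v) y := by
  have hd : HasCompactSupport fun y => fderiv ℝ φ y (e j) := hc.fderiv_apply ℝ _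
  have h := integral_bilinear_hasLineDerivAt_right_eq_neg_left_of_integrable
    (μ := (volume : Measure E)) (B := ContinuousLinearMap.lsmul ℝ ℝ) (f := φ)
    (f' := fun y => fderiv ℝ φ y (e j)) (g := mode k v) (g' := mode k (freq k j • v)) (v := e j)
    (((continuous_fderiv_dir hφ (e j)).smul (mode k v).continuous).integrable_of_hasCompactSupport
      hd.smul_right)
    ((hφ.continuous.smul (mode k _).continuous).integrable_of_hasCompactSupport hc.smul_right)
    ((hφ.continuous.smul (mode k _).continuous).integrable_of_hasCompactSupport hc.smul_right)
    (fun y _ => (hφ.differentiable (by simp) y).hasFDerivAt.hasLineDerivAt (e j))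
    (fun y _ => hasLineDerivAt_mode k v j y)
  simp only [ContinuousLinearMap.lsmul_apply] at h
  rw [setIntegral_eq_integral_of_forall_compl_eq_zero,
    setIntegral_eq_integral_of_forall_compl_eq_zero, h, neg_neg]
  · intro y hy
    rw [image_eq_zero_of_notMem_tsupport fun h => hy (hs h), zero_smul]
  · intro y hy
    have : fderiv ℝ φ y = 0 := image_eq_zero_of_notMem_tsupport fun h =>
      hy (hs (tsupport_fderiv_subset ℝ h))
    rw [this, zero_apply, zero_smul]

theorem inner_integral_smul (ψ : E → ℝ) (hψ : Continuous ψ) (hc : HasCompactSupport ψ)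
    (u : L2Cell) (z : E) :
    ⟪z, ∫ y in cell, ψ y • u y⟫ = ⟪u, toL2 (ofCompactSupport (fun y => ψ y • z)
      (hψ.smul continuous_const) hc.smul_right)⟫ := by
  rw [← integral_inner (integrable_test_smul ψ hψ hc u), inner_toL2]
  refine integral_congr_ae (Filter.Eventually.of_forall fun y => ?_)
  change ⟪z, ψ y • u y⟫ = ⟪u y, ψ y • z⟫
  rw [real_inner_smul_right, real_inner_smul_right, real_inner_comm]

theorem hasSum_inner_left {ι : Type*} {u : ι → L2Cell} {u₀ : L2Cell} (hu : HasSum u u₀)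
    (f : L2Cell) : HasSum (fun n => ⟪u n, f⟫) ⟪u₀, f⟫ := by
  simpa only [real_inner_comm f] using! (innerSL ℝ f).hasSum hu

theorem isWeakPartial_synth {j : Fin 3} {c d : Seq} (h : ∀ k, d k = freq k j • c k) :
    IsWeakPartial j (synth c) (synth d) := by
  intro φ hφ hc hs
  have hd : HasCompactSupport fun y => fderiv ℝ φ y (e j) := hc.fderiv_apply ℝ _
  refine ext_inner_left ℝ fun z => ?_
  rw [inner_neg_right, inner_integral_smul _ (continuous_fderiv_dir hφ _) hd,
    inner_integral_smul _ hφ.continuous hc]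
  -- Both sides are continuous linear functionals of the field, so it suffices to compare them mode
  -- by mode.
  refine (hasSum_inner_left (hasSum_synth c) _).unique
    ((hasSum_inner_left (hasSum_synth d) _).neg.congr_fun fun k => ?_)
  rw [← inner_integral_smul _ (continuous_fderiv_dir hφ _) hd,
    ← inner_integral_smul _ hφ.continuous hc, ← inner_neg_right, h k]
  congr 1
  have h1 (ψ : E → ℝ) (w : C3) : ∫ y in cell, ψ y • toL2 (mode k w) y =
      ∫ y in cell, ψ y • mode k w y := by
    refine integral_congr_ae ?_
    filter_upwards [coeFn_toL2 (mode k w)] with y hy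
    rw [hy]
  rw [h1, h1]
  exact integral_smul_mode φ hφ hc hs j k (c k)

/-- Integrals over `ℝ³` against a periodic extension are integrals over `Y`. -/
theorem exists_periodization {θ : E → E} (hθ : Continuous θ) (hc : HasCompactSupport θ) :
    ∃ Θ : E →ᵇ E, ∀ u : L2Cell, ∫ y, ⟪perExt u y, θ y⟫ = ⟪u, toL2 Θ⟫ := by
  obtain ⟨R, hR⟩ := hc.isCompact.isBounded.exists_norm_le
  obtain ⟨M, hM⟩ := exists_nat_ge (R + 1)
  let s : Finset (Fin 3 → ℤ) := Fintype.piFinset fun _ => Finset.Icc (-(M : ℤ)) M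
  let T (n : Fin 3 → ℤ) : E →ᵇ E :=
    (ofCompactSupport θ hθ hc).compContinuous ⟨fun y => y + latticeVec n, by fun_prop⟩
  have hT (n : Fin 3 → ℤ) (y : E) : T n y = θ (y + latticeVec n) := rfl
  refine ⟨∑ n ∈ s, T n, fun u => ?_⟩
  have hcell (n : Fin 3 → ℤ) : ∀ y ∈ cell,
      ⟪perExt u (y + latticeVec n), θ (y + latticeVec n)⟫ = ⟪u y, T n y⟫ := fun y hy => by
    rw [isPer_perExt, hT, perExt, cellFract_of_mem_cell hy]
  have hae (n : Fin 3 → ℤ) : (fun y => ⟪u y, T n y⟫) =ᵐ[cellMeasure]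
      fun y => ⟪u y, toL2 (T n) y⟫ := by
    filter_upwards [coeFn_toL2 (T n)] with y hy
    rw [hy]
  rw [integral_eq_sum_cell s, map_sum, inner_sum]
  · refine Finset.sum_congr rfl fun n _ => ?_
    rw [inner_toL2]
    exact setIntegral_congr_fun measurableSet_cell (hcell n)
  · intro y _ h0
    have hy : ‖y‖ ≤ R := hR y (subset_tsupport _ fun h => h0 (by rw [h, inner_zero_right]))
    rw [Fintype.mem_piFinset]
    intro i
    obtain ⟨ha, hb⟩ := abs_le.1 ((PiLp.norm_apply_le y i).trans hy)
    rw [Finset.mem_Icc]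
    constructor
    · rw [Int.le_floor]
      push_cast
      linarith
    · have := Int.floor_le (y i)
      have h3 : ((⌊y i⌋ : ℤ) : ℝ) ≤ ((M : ℤ) : ℝ) := by push_cast; linarith
      exact_mod_cast h3
  · intro n
    refine IntegrableOn.congr_fun ?_ (fun y hy => (hcell n y hy).symm) measurableSet_cell
    exact (L2.integrable_inner (𝕜 := ℝ) u (toL2 (T n))).congr (hae n).symm

theorem perExt_toL2_mode (k : Fin 3 → ℤ) (v : C3) :
    perExt (toL2 (mode k v)) =ᵐ[volume] mode k v := by
  have h := perExt_congr (coeFn_toL2 (mode k v))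
  have h2 : perExt (mode k v) = mode k v := IsPer.perExt fun n y => mode_add_latticeVec k n v y
  rwa [h2] at h

theorem integral_perExt_mode (k : Fin 3 → ℤ) (v : C3) (θ : E → E) :
    ∫ y, ⟪perExt (toL2 (mode k v)) y, θ y⟫ = ∫ y, ⟪mode k v y, θ y⟫ := by
  refine integral_congr_ae ?_
  filter_upwards [perExt_toL2_mode k v] with y hy
  rw [hy]

theorem integral_inner_of_hasSum {θ : E → E} (hθ : Continuous θ) (hc : HasCompactSupport θ)
    {ι : Type*} {u : ι → L2Cell} {u₀ : L2Cell} (hu : HasSum u u₀) :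
    HasSum (fun n => ∫ y, ⟪perExt (u n) y, θ y⟫) (∫ y, ⟪perExt u₀ y, θ y⟫) := by
  obtain ⟨Θ, hΘ⟩ := exists_periodization hθ hc
  simp only [hΘ]
  exact hasSum_inner_left hu _

/-- The `j`-th vector of the canonical basis, as a family of real numbers. -/
abbrev unitFam (j : Fin 3) : Fin 3 → ℝ := Pi.single j 1

theorem curl_eq_sum (φ : E → E) (y : E) :
    curl φ y = ∑ j, crossE (unitFam j) (fderiv ℝ φ y (e j)) := by
  ext i
  fin_cases i <;> simp [curl, crossE_apply, Fin.sum_univ_three, unitFam, Pi.single_apply] <;> ring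

theorem crossC_eq_sum (w : Fin 3 → ℂ) (v : C3) :
    crossC w v = ∑ j, crossC (fun i => (unitFam j i : ℂ)) (w j • v) := by
  ext i
  fin_cases i <;>
    simp [crossC_apply, Fin.sum_univ_three, unitFam, Pi.single_apply] <;> ring

theorem integral_inner_mode_fderiv (φ : E → E) (hφ : ContDiff ℝ ∞ φ) (hc : HasCompactSupport φ)
    (k : Fin 3 → ℤ) (v : C3) (j : Fin 3) :
    ∫ y, ⟪mode k v y, fderiv ℝ φ y (e j)⟫ = -∫ y, ⟪mode k (freq k j • v) y, φ y⟫ := by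
  have hd : HasCompactSupport fun y => fderiv ℝ φ y (e j) := hc.fderiv_apply ℝ _
  have hi (f g : E → E) (hf : Continuous f) (hg : Continuous g) (hgc : HasCompactSupport g) :
      Integrable fun y => ⟪f y, g y⟫ :=
    (hf.inner hg).integrable_of_hasCompactSupport (hgc.mono fun y hy h0 => hy (by
      simp only [h0, inner_zero_right]))
  have h := integral_bilinear_hasLineDerivAt_right_eq_neg_left_of_integrable
    (μ := (volume : Measure E)) (B := innerSL ℝ) (f := mode k v)
    (f' := mode k (freq k j • v)) (g := φ) (g' := fun y => fderiv ℝ φ y (e j)) (v := e j)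
    (hi _ _ (mode k _).continuous hφ.continuous hc)
    (hi _ _ (mode k _).continuous (continuous_fderiv_dir hφ _) hd)
    (hi _ _ (mode k _).continuous hφ.continuous hc)
    (fun y _ => hasLineDerivAt_mode k v j y)
    (fun y _ => (hφ.differentiable (by simp) y).hasFDerivAt.hasLineDerivAt (e j))
  exact h

theorem integral_inner_mode_curl (φ : E → E) (hφ : ContDiff ℝ ∞ φ) (hc : HasCompactSupport φ)
    (k : Fin 3 → ℤ) (v : C3) :
    ∫ y, ⟪mode k v y, curl φ y⟫ = ∫ y, ⟪mode k (crossC (freq k) v) y, φ y⟫ := by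
  have hd (j : Fin 3) : HasCompactSupport fun y => fderiv ℝ φ y (e j) := hc.fderiv_apply ℝ _
  have hi (f g : E → E) (hf : Continuous f) (hg : Continuous g) (hgc : HasCompactSupport g) :
      Integrable fun y => ⟪f y, g y⟫ :=
    (hf.inner hg).integrable_of_hasCompactSupport (hgc.mono fun y hy h0 => hy (by
      simp only [h0, inner_zero_right]))
  have h1 (y : E) : ⟪mode k v y, curl φ y⟫ =
      -∑ j, ⟪mode k (crossC (fun i => (unitFam j i : ℂ)) v) y, fderiv ℝ φ y (e j)⟫ := by
    rw [curl_eq_sum, inner_sum, ← Finset.sum_neg_distrib]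
    refine Finset.sum_congr rfl fun j _ => ?_
    rw [mode_crossC, inner_crossE, neg_neg]
  have h2 (y : E) : ⟪mode k (crossC (freq k) v) y, φ y⟫ =
      ∑ j, ⟪mode k (freq k j • crossC (fun i => (unitFam j i : ℂ)) v) y, φ y⟫ := by
    rw [crossC_eq_sum, map_sum, BoundedContinuousFunction.sum_apply, sum_inner]
    simp_rw [crossC_smul]
  simp_rw [h1, h2]
  rw [integral_neg, integral_finsetSum, integral_finsetSum, ← Finset.sum_neg_distrib]
  · refine Finset.sum_congr rfl fun j _ => ?_
    rw [integral_inner_mode_fderiv φ hφ hc, neg_neg]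
  · exact fun j _ => hi _ _ (mode k _).continuous hφ.continuous hc
  · exact fun j _ => hi _ _ (mode k _).continuous (continuous_fderiv_dir hφ _) (hd j)

theorem isPerWeakCurl_synth {c d : Seq} (h : ∀ k, d k = crossC (freq k) (c k)) :
    IsPerWeakCurl (synth c) (synth d) := by
  intro φ hφ hc
  refine (integral_inner_of_hasSum (continuous_curl hφ) (hasCompactSupport_curl hc)
    (hasSum_synth c)).unique ((integral_inner_of_hasSum hφ.continuous hc
      (hasSum_synth d)).congr_fun fun k => ?_)
  rw [integral_perExt_mode, integral_perExt_mode, integral_inner_mode_curl φ hφ hc, h k]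

theorem isPerDivFree_synth {c : Seq} (h : ∀ k, ∑ j, freq k j * c k j = 0) :
    IsPerDivFree (synth c) := by
  intro φ hφ hc
  let θ (y : E) : E := WithLp.toLp 2 fun j => fderiv ℝ φ y (e j)
  have hθ : Continuous θ := (PiLp.continuous_toLp 2 (fun _ : Fin 3 => ℝ)).comp
    (continuous_pi fun j => continuous_fderiv_dir hφ (e j))
  have hθc : HasCompactSupport θ := (hc.fderiv ℝ).mono fun y hy h0 => hy (by
    ext j; simp [θ, h0])
  have h1 (y w : E) : fderiv ℝ φ y w = ⟪w, θ y⟫ := by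
    have : w = ∑ j, w j • e j := by
      ext i; simp [e, Finset.sum_apply, Pi.single_apply]
    conv_lhs => rw [this]
    rw [map_sum, PiLp.inner_apply]
    refine Finset.sum_congr rfl fun j _ => ?_
    rw [map_smul]
    simp [θ, mul_comm]
  simp_rw [h1]
  refine (integral_inner_of_hasSum hθ hθc (hasSum_synth c)).unique
    (hasSum_zero.congr_fun fun k => ?_)
  rw [integral_perExt_mode]
  have h2 (y : E) : ⟪mode k (c k) y, θ y⟫ =
      -- Every scalar component is placed in the first coordinate, so that the integration by parts
      -- already available for vector fields applies to `φ • e 0`.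
      ∑ j, ⟪mode k (EuclideanSpace.single 0 (c k j)) y, fderiv ℝ (fun z => φ z • e 0) y (e j)⟫ := by
    rw [PiLp.inner_apply]
    refine Finset.sum_congr rfl fun j _ => ?_
    rw [fderiv_smul_const (hφ.differentiable (by simp) y)]
    simp [θ, mode_apply, e, PiLp.inner_apply, inner_smul_right]
  have hφ0 : ContDiff ℝ ∞ fun z => φ z • e 0 := hφ.smul contDiff_const
  have hc0 : HasCompactSupport fun z => φ z • e 0 := hc.smul_right
  have hi (f g : E → E) (hf : Continuous f) (hg : Continuous g) (hgc : HasCompactSupport g) :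
      Integrable fun y => ⟪f y, g y⟫ :=
    (hf.inner hg).integrable_of_hasCompactSupport (hgc.mono fun y hy h0 => hy (by
      simp only [h0, inner_zero_right]))
  simp_rw [h2]
  rw [integral_finsetSum]
  · simp_rw [integral_inner_mode_fderiv _ hφ0 hc0]
    rw [Finset.sum_neg_distrib, ← integral_finsetSum]
    · have h3 (y : E) : ∑ j, ⟪mode k (freq k j • EuclideanSpace.single 0 (c k j)) y, φ y • e 0⟫ = 0 := by
        rw [← sum_inner, ← BoundedContinuousFunction.sum_apply, ← map_sum]
        have h4 : ∑ j, freq k j • (EuclideanSpace.single 0 (c k j) : C3) = 0 := by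
          ext i
          fin_cases i
          · simpa using h k
          · simp
          · simp
        rw [h4]
        simp
      simp_rw [h3]
      simp
    · exact fun j _ => hi _ _ (mode k _).continuous hφ0.continuous hc0
  · exact fun j _ => hi _ _ (mode k _).continuous (continuous_fderiv_dir hφ0 _)
      (hc0.fderiv_apply ℝ _)

/-! ### Divergence-free fields -/

/-- Symmetry of the curl on one frequency: the cross product is antisymmetric and the frequencies
are imaginary, so the two signs cancel. -/
theorem crossC_conj_freq (k : Fin 3 → ℤ) (u v : C3) :
    ⟪u, crossC (freq k) v⟫ = ⟪crossC (freq k) u, v⟫ := by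
  have : (fun j => (starRingEnd ℂ) (freq k j)) = (-1 : ℂ) • freq k := by
    funext j; simp [conj_freq]
  rw [inner_crossC, this, crossC_smul_left]
  simp

theorem integral_inner_perExt {u : L2Cell} {m : E →ᵇ E} (hm : IsPer m) :
    (∫ y, cutoff y * ⟪perExt u y, m y⟫ = ⟪u, toL2 m⟫) ∧
      ∀ v, ∫ y, fderiv ℝ cutoff y v * ⟪perExt u y, m y⟫ = 0 := by
  have hp : IsPer fun y => ⟪perExt u y, m y⟫ := fun n y => by
    simp only [isPer_perExt _ n y, hm n y]
  have heq : ∀ y ∈ cell, ⟪perExt u y, m y⟫ = ⟪u y, m y⟫ := fun y hy => by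
    rw [perExt, cellFract_of_mem_cell hy]
  have hi : IntegrableOn (fun y => ⟪perExt u y, m y⟫) cell := by
    refine IntegrableOn.congr_fun ?_ (fun y hy => (heq y hy).symm) measurableSet_cell
    refine (L2.integrable_inner (𝕜 := ℝ) u (toL2 m)).congr ?_
    filter_upwards [coeFn_toL2 m] with y hy
    rw [hy]
  refine ⟨?_, integral_fderiv_cutoff_mul hp hi⟩
  rw [integral_cutoff_mul hp hi, inner_toL2]
  exact setIntegral_congr_fun measurableSet_cell heq

/-- Modes are not compactly supported, so the test field is `cutoff • mode k v`. In the product rule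
the terms carrying a derivative of `cutoff` vanish, and the others integrate to integrals over one
cell. -/
theorem coef_of_isPerWeakCurl {u w : L2Cell} (h : IsPerWeakCurl u w) (k : Fin 3 → ℤ) :
    coef k w = crossC (freq k) (coef k u) := by
  refine ext_inner_right ℝ fun v => ?_
  rw [← crossC_conj_freq, inner_coef, inner_coef]
  have hper (v : C3) : IsPer (mode k v) := fun n y => mode_add_latticeVec k n v y
  have hs : ContDiff ℝ ∞ fun y => cutoff y • mode k v y := contDiff_cutoff.smul (contDiff_mode k v)
  have hc : HasCompactSupport fun y => cutoff y • mode k v y := hasCompactSupport_cutoff.smul_right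
  have h1 := h _ hs hc
  simp only [real_inner_smul_right] at h1
  rw [(integral_inner_perExt (hper v)).1] at h1
  rw [← h1]
  let X (j : Fin 3) (v : C3) : C3 := crossC (fun i => (unitFam j i : ℂ)) v
  have h2 (y : E) : ⟪perExt u y, curl (fun y => cutoff y • mode k v y) y⟫ =
      ∑ j, (fderiv ℝ cutoff y (e j) * ⟪perExt u y, mode k (X j v) y⟫ +
        cutoff y * ⟪perExt u y, mode k (X j (freq k j • v)) y⟫) := by
    rw [curl_eq_sum, inner_sum]
    refine Finset.sum_congr rfl fun j _ => ?_
    have hd : fderiv ℝ (mode k v) y (e j) = mode k (freq k j • v) y :=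
      (((contDiff_mode k v).differentiable (by simp) y).hasFDerivAt.hasLineDerivAt (e j)).unique
        (hasLineDerivAt_mode k v j y)
    rw [fderiv_fun_smul (contDiff_cutoff.differentiable (by simp) y)
      ((contDiff_mode k v).differentiable (by simp) y)]
    simp only [add_apply, smul_apply, ContinuousLinearMap.smulRight_apply, hd, map_add,
      map_smul, inner_add_right, real_inner_smul_right, X, mode_crossC]
    ring
  have hi1 (ψ : E → ℝ) (hψ : Continuous ψ) (hψc : HasCompactSupport ψ) (v : C3) :
      Integrable fun y => ψ y * ⟪perExt u y, mode k v y⟫ := by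
    simpa only [real_inner_smul_right] using integrable_perExt_inner u
      (ψ := fun y => ψ y • mode k v y) (hψ.smul (mode k v).continuous) hψc.smul_right
  simp_rw [h2]
  rw [integral_finsetSum]
  · rw [crossC_eq_sum, map_sum, map_sum, inner_sum]
    refine Finset.sum_congr rfl fun j _ => ?_
    rw [integral_add, (integral_inner_perExt (hper _)).1, (integral_inner_perExt (hper _)).2,
      zero_add]
    · exact hi1 _ (continuous_fderiv_cutoff _) (hasCompactSupport_fderiv_cutoff _) _
    · exact hi1 _ contDiff_cutoff.continuous hasCompactSupport_cutoff _
  · exact fun j _ => (hi1 _ (continuous_fderiv_cutoff _) (hasCompactSupport_fderiv_cutoff _) _).add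
      (hi1 _ contDiff_cutoff.continuous hasCompactSupport_cutoff _)

/-- The fields in `L²(Y)³` with mean zero whose periodic extension is divergence-free. -/
def divFree : Submodule ℝ L2Cell where
  carrier := {w | coef 0 w = 0 ∧ ∀ k, ∑ j, freq k j * coef k w j = 0}
  add_mem' := by
    rintro u w ⟨h1, h2⟩ ⟨k1, k2⟩
    refine ⟨by rw [map_add, h1, k1, add_zero], fun k => ?_⟩
    simp only [map_add, PiLp.add_apply, mul_add, Finset.sum_add_distrib, h2, k2, add_zero]
  zero_mem' := ⟨map_zero _, fun k => by simp⟩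
  smul_mem' := by
    rintro c u ⟨h1, h2⟩
    refine ⟨by rw [map_smul, h1, smul_zero], fun k => ?_⟩
    have := h2 k
    simp only [map_smul, PiLp.smul_apply, mul_smul_comm, ← Finset.smul_sum, this, smul_zero]

theorem isClosed_divFree : IsClosed (divFree : Set L2Cell) := by
  have : (divFree : Set L2Cell) =
      {w | coef 0 w = 0} ∩ ⋂ k, {w | ∑ j, freq k j * coef k w j = 0} := by
    ext w; simp [divFree]
  rw [this]
  refine (isClosed_eq (coef 0).continuous continuous_const).inter
    (isClosed_iInter fun k => isClosed_eq ?_ continuous_const)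
  refine continuous_finsetSum _ fun j _ => continuous_const.mul ?_
  exact (EuclideanSpace.proj (𝕜 := ℂ) j).continuous.comp (coef k).continuous

instance : CompleteSpace divFree := isClosed_divFree.completeSpace_coe

theorem sum_freq_mul_crossC (k : Fin 3 → ℤ) (v : C3) :
    ∑ j, freq k j * crossC (freq k) v j = 0 := by
  simp [Fin.sum_univ_three, crossC_apply]
  ring

theorem freq_zero : freq 0 = 0 := by funext j; simp [freq]

theorem crossC_zero (v : C3) : crossC 0 v = 0 := by
  ext i; fin_cases i <;> simp [crossC_apply]

theorem mem_divFree_of_coef {w : L2Cell} (c : (Fin 3 → ℤ) → C3)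
    (h : ∀ k, coef k w = crossC (freq k) (c k)) : w ∈ divFree := by
  refine ⟨by rw [h, freq_zero, crossC_zero], fun k => ?_⟩
  rw [h, sum_freq_mul_crossC]

theorem mem_divFree_of_isPerWeakCurl {u w : L2Cell} (h : IsPerWeakCurl u w) : w ∈ divFree :=
  mem_divFree_of_coef _ (coef_of_isPerWeakCurl h)

/-- A mode with nonzero frequency is itself the partial derivative of a mode, and derivatives of
periodic fields have mean zero. -/
theorem coef_zero_mode {k : Fin 3 → ℤ} (hk : k ≠ 0) (v : C3) : coef 0 (toL2 (mode k v)) = 0 := by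
  obtain ⟨j, hj⟩ := Function.ne_iff.1 hk
  have hf : freq k j ≠ 0 := by
    simpa [freq, Real.pi_ne_zero] using hj
  have h := (isC1Per_mode k ((freq k j)⁻¹ • v)).hasPartial j 0
  rwa [freq_zero, Pi.zero_apply, zero_smul, smul_inv_smul₀ hf] at h

theorem integral_synth_eq_zero {c : Seq} (h : c 0 = 0) : ∫ y in cell, synth c y = 0 := by
  have h1 : coef 0 (synth c) = 0 := by
    refine ((coef 0).hasSum (hasSum_synth c)).unique (hasSum_zero.congr_fun fun k => ?_)
    by_cases hk : k = 0
    · subst hk; rw [h, map_zero, map_zero, map_zero]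
    · exact coef_zero_mode hk _
  have hi : Integrable (synth c) cellMeasure := (Lp.memLp (synth c)).integrable (by norm_num)
  ext i
  have h2 := congrArg (fun v : C3 => v i) h1
  simp only [coef_apply, neg_zero, expo_zero, one_mul] at h2
  rw [integral_complex_ofReal] at h2
  have h3 : ∫ y in cell, synth c y i = (∫ y in cell, synth c y) i :=
    (EuclideanSpace.proj (𝕜 := ℝ) i : E →L[ℝ] ℝ).integral_comp_comm hi
  rw [← h3]
  simpa using h2

/-! ### Fourier multipliers -/

/-- The symbol `4π²|k|²` of `-Δ`. -/
def lapl (k : Fin 3 → ℤ) : ℝ := ∑ j, ‖freq k j‖ ^ 2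

theorem lapl_nonneg (k : Fin 3 → ℤ) : 0 ≤ lapl k := Finset.sum_nonneg fun j _ => by positivity

theorem norm_freq_sq_le (k : Fin 3 → ℤ) (j : Fin 3) : ‖freq k j‖ ^ 2 ≤ lapl k :=
  Finset.single_le_sum (f := fun j => ‖freq k j‖ ^ 2) (fun i _ => by positivity)
    (Finset.mem_univ j)

theorem norm_freq (k : Fin 3 → ℤ) (j : Fin 3) : ‖freq k j‖ = 2 * Real.pi * |(k j : ℝ)| := by
  simp [freq, abs_of_pos Real.pi_pos]

theorem norm_freq_mul_le (k : Fin 3 → ℤ) (i j : Fin 3) : ‖freq k i‖ * ‖freq k j‖ ≤ lapl k := by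
  nlinarith [norm_freq_sq_le k i, norm_freq_sq_le k j, sq_nonneg (‖freq k i‖ - ‖freq k j‖)]

/-- Frequencies are discrete: a nonzero one has modulus at least `2π ≥ 1`, so it is bounded by its
square. This is what makes `curl (-Δ)⁻¹` bounded on the periodic cell. -/
theorem norm_freq_le (k : Fin 3 → ℤ) (j : Fin 3) : ‖freq k j‖ ≤ lapl k := by
  refine le_trans ?_ (norm_freq_sq_le k j)
  by_cases h : k j = 0
  · simp [freq, h]
  · have h1 : (1 : ℝ) ≤ |(k j : ℝ)| := by exact_mod_cast Int.one_le_abs h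
    have h2 : 1 ≤ ‖freq k j‖ := by
      rw [norm_freq]
      nlinarith [Real.pi_gt_three]
    nlinarith

theorem norm_div_lapl_le {k : Fin 3 → ℤ} {z : ℂ} (h : ‖z‖ ≤ lapl k) : ‖z / lapl k‖ ≤ 1 := by
  rw [norm_div, Complex.norm_real, Real.norm_eq_abs, abs_of_nonneg (lapl_nonneg k)]
  exact div_le_one_of_le₀ h (lapl_nonneg k)

theorem norm_div_one_add_lapl_le {k : Fin 3 → ℤ} {z : ℂ} (h : ‖z‖ ≤ 1 + lapl k) :
    ‖z / (1 + lapl k : ℝ)‖ ≤ 1 := by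
  have := lapl_nonneg k
  rw [norm_div, Complex.norm_real, Real.norm_eq_abs, abs_of_nonneg (by positivity)]
  exact div_le_one_of_le₀ h (by positivity)

theorem lapl_eq_zero {k : Fin 3 → ℤ} (h : lapl k = 0) : k = 0 := by
  funext j
  have h1 := norm_freq_sq_le k j
  rw [h, norm_freq] at h1
  have h2 : 2 * Real.pi * |(k j : ℝ)| = 0 := by
    have h3 : 0 ≤ 2 * Real.pi * |(k j : ℝ)| := by positivity
    nlinarith
  simpa [Real.pi_ne_zero] using h2

/-- Multiplication by a bounded scalar symbol. -/
def diagScale (z : (Fin 3 → ℤ) → ℂ) (hz : ∀ k, ‖z k‖ ≤ 1) : Seq →L[ℝ] Seq :=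
  diag (fun k => z k • ContinuousLinearMap.id ℝ C3) 1 fun k v => by
    rw [smul_apply, norm_smul]
    exact mul_le_mul_of_nonneg_right (hz k) (norm_nonneg v)

theorem diagScale_apply (z : (Fin 3 → ℤ) → ℂ) (hz : ∀ k, ‖z k‖ ≤ 1) (c : Seq) (k : Fin 3 → ℤ) :
    diagScale z hz c k = z k • c k := rfl

/-- The cross product with a bounded vector-valued symbol. -/
def diagCross (w : (Fin 3 → ℤ) → Fin 3 → ℂ) (hw : ∀ k j, ‖w k j‖ ≤ 1) : Seq →L[ℝ] Seq :=
  diag (fun k => crossC (w k)) (6 * 1) fun k => norm_crossC_le (hw k)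

/-- The operator `curl (-Δ)⁻¹`. -/
def potential : Seq →L[ℝ] Seq :=
  diagCross (fun k j => freq k j / lapl k) fun k j => norm_div_lapl_le (norm_freq_le k j)

/-- The operator `∂ᵢ curl (-Δ)⁻¹`. -/
def partialPotential (i : Fin 3) : Seq →L[ℝ] Seq :=
  diagCross (fun k j => freq k i * freq k j / lapl k) fun k j =>
    norm_div_lapl_le ((norm_mul _ _).trans_le (norm_freq_mul_le k i j))

/-- At `k = 0` division by zero gives the symbol the value `0`, the wanted convention for `(-Δ)⁻¹`
on mean-free fields. -/
theorem potential_apply (c : Seq) (k : Fin 3 → ℤ) :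
    potential c k = (lapl k : ℂ)⁻¹ • crossC (freq k) (c k) := by
  have : (fun j => freq k j / lapl k) = (lapl k : ℂ)⁻¹ • freq k := by
    funext j
    simp [div_eq_inv_mul]
  rw [← crossC_smul_left, ← this]
  rfl

theorem partialPotential_apply (i : Fin 3) (c : Seq) (k : Fin 3 → ℤ) :
    partialPotential i c k = freq k i • potential c k := by
  have : (fun j => freq k i * freq k j / lapl k) = (freq k i * (lapl k : ℂ)⁻¹) • freq k := by
    funext j
    simp [div_eq_mul_inv]
    ring
  rw [potential_apply, smul_smul, ← crossC_smul_left, ← this]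
  rfl

/-- The operator `(1 - Δ)⁻¹`. -/
def bessel : Seq →L[ℝ] Seq :=
  diagScale (fun k => 1 / (1 + lapl k : ℝ)) fun k => norm_div_one_add_lapl_le (by
    have := lapl_nonneg k
    simpa using this)

/-- The operator `∂ᵢ (1 - Δ)⁻¹`. -/
def besselPartial (i : Fin 3) : Seq →L[ℝ] Seq :=
  diagScale (fun k => freq k i / (1 + lapl k : ℝ)) fun k => norm_div_one_add_lapl_le (by
    linarith [norm_freq_le k i])

/-- The operator `∂ⱼ ∂ᵢ (1 - Δ)⁻¹`. -/
def besselPartial₂ (i j : Fin 3) : Seq →L[ℝ] Seq :=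
  diagScale (fun k => freq k j * freq k i / (1 + lapl k : ℝ)) fun k => norm_div_one_add_lapl_le (by
    rw [norm_mul]
    linarith [norm_freq_mul_le k j i])

theorem bessel_apply (c : Seq) (k : Fin 3 → ℤ) :
    bessel c k = ((1 + lapl k : ℝ) : ℂ)⁻¹ • c k := by
  rw [bessel, diagScale_apply, one_div]

theorem besselPartial_apply (i : Fin 3) (c : Seq) (k : Fin 3 → ℤ) :
    besselPartial i c k = freq k i • bessel c k := by
  rw [bessel_apply, smul_smul, ← div_eq_mul_inv]
  rfl

theorem besselPartial₂_apply (i j : Fin 3) (c : Seq) (k : Fin 3 → ℤ) :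
    besselPartial₂ i j c k = freq k j • besselPartial i c k := by
  rw [besselPartial_apply, bessel_apply, smul_smul, smul_smul, ← div_eq_mul_inv]
  rfl

/-- The element of `H²(Y)³` with the Fourier coefficients `(1 + 4π²|k|²)⁻¹ c k`. -/
def toH2 : Seq →L[ℝ] H2Cell :=
  ContinuousLinearMap.codRestrict
    ((synth.comp bessel).prod ((ContinuousLinearMap.pi fun i => synth.comp (besselPartial i)).prod
      (ContinuousLinearMap.pi fun i => ContinuousLinearMap.pi fun j =>
        synth.comp (besselPartial₂ i j)))) H2Cell fun c =>
    ⟨fun i => isWeakPartial_synth (besselPartial_apply i c),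
      fun i j => isWeakPartial_synth (besselPartial₂_apply i j c)⟩

theorem coe_toH2 (c : Seq) : (toH2 c).1.1 = synth (bessel c) := rfl

/-! ### The Sobolev embedding -/

theorem summable_pi_prod {a : ℤ → ℝ} (ha : ∀ n, 0 ≤ a n) (hs : Summable a) :
    Summable fun k : Fin 3 → ℤ => ∏ i, a (k i) := by
  refine summable_of_sum_le (c := (∑' n, a n) ^ 3)
    (fun k => Finset.prod_nonneg fun i _ => ha _) fun u => ?_
  calc ∑ k ∈ u, ∏ i, a (k i)
      ≤ ∑ k ∈ Fintype.piFinset fun i => u.image fun k => k i, ∏ i, a (k i) := by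
        refine Finset.sum_le_sum_of_subset_of_nonneg (fun k hk => ?_)
          fun k _ _ => Finset.prod_nonneg fun i _ => ha _
        exact Fintype.mem_piFinset.2 fun i => Finset.mem_image_of_mem _ hk
    _ = ∏ i : Fin 3, ∑ n ∈ u.image fun k => k i, a n := (Finset.prod_univ_sum _ _).symm
    _ ≤ ∏ _i : Fin 3, ∑' n, a n := Finset.prod_le_prod
        (fun i _ => Finset.sum_nonneg fun n _ => ha n) fun i _ => hs.sum_le_tsum _ fun n _ => ha n
    _ = (∑' n, a n) ^ 3 := by simp

/-- Each `max 1 |k i| ^ 2` is at most `1 + lapl k`. Splitting the exponent `2` into three equal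
parts `2 / 3` bounds the term by a product of one-dimensional terms with exponent `4 / 3`, which
exceeds `1`. Dimension three enters here. -/
theorem summable_bessel_sq : Summable fun k : Fin 3 → ℤ => ((1 + lapl k)⁻¹) ^ 2 := by
  have h1 : Summable fun n : ℤ => (max 1 |(n : ℝ)|) ^ (-(4 / 3) : ℝ) := by
    refine ((Real.summable_abs_int_rpow (b := 4 / 3) (by norm_num)).add
      (hasSum_ite_eq (0 : ℤ) (1 : ℝ)).summable).of_nonneg_of_le (fun n => by positivity) fun n => ?_
    by_cases hn : n = 0
    · subst hn
      simp
    · have h1 : (1 : ℝ) ≤ |(n : ℝ)| := by exact_mod_cast Int.one_le_abs hn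
      simp [hn, h1]
  refine (summable_pi_prod (fun n => by positivity) h1).of_nonneg_of_le
    (fun k => by positivity) fun k => ?_
  have hl := lapl_nonneg k
  have h2 (i : Fin 3) : (max 1 |(k i : ℝ)|) ^ 2 ≤ 1 + lapl k := by
    have h3 := norm_freq_sq_le k i
    rw [norm_freq] at h3
    rcases max_cases 1 |(k i : ℝ)| with h | h
    · rw [h.1]; linarith
    · rw [h.1]
      have := Real.pi_gt_three
      have h5 : |(k i : ℝ)| ≤ 2 * Real.pi * |(k i : ℝ)| :=
        le_mul_of_one_le_left (abs_nonneg _) (by linarith)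
      nlinarith [pow_le_pow_left₀ (abs_nonneg (k i : ℝ)) h5 2]
  have h3 (i : Fin 3) : (1 + lapl k) ^ (-(2 / 3) : ℝ) ≤ (max 1 |(k i : ℝ)|) ^ (-(4 / 3) : ℝ) := by
    have hm : 0 < max 1 |(k i : ℝ)| := by positivity
    have : (max 1 |(k i : ℝ)|) ^ (-(4 / 3) : ℝ) = ((max 1 |(k i : ℝ)|) ^ 2) ^ (-(2 / 3) : ℝ) := by
      rw [← Real.rpow_natCast, ← Real.rpow_mul hm.le]
      norm_num
    rw [this]
    exact Real.rpow_le_rpow_of_nonpos (by positivity) (h2 i) (by norm_num)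
  calc ((1 + lapl k)⁻¹) ^ 2 = ∏ _i : Fin 3, (1 + lapl k) ^ (-(2 / 3) : ℝ) := by
        rw [Finset.prod_const, ← Real.rpow_natCast _ (Finset.card _), ← Real.rpow_mul (by positivity),
          inv_pow, ← Real.rpow_natCast, ← Real.rpow_neg (by positivity)]
        norm_num
    _ ≤ _ := Finset.prod_le_prod (fun i _ => by positivity) fun i _ => h3 i

/-- Cauchy–Schwarz. The left side dominates the sup norms of the modes, so this is the embedding of
`H²` into continuous functions. -/
theorem summable_bessel_mul (c : Seq) :
    Summable (fun k => (1 + lapl k)⁻¹ * ‖c k‖) ∧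
      ∑' k, (1 + lapl k)⁻¹ * ‖c k‖ ≤ √(∑' k, ((1 + lapl k)⁻¹) ^ 2) * ‖c‖ := by
  have hc : Summable fun k => ‖c k‖ ^ 2 := by
    simpa using (lp.memℓp c).summable (by norm_num)
  have hn := lp.norm_rpow_eq_tsum (p := 2) (by norm_num) c
  simp only [ENNReal.toReal_ofNat, Real.rpow_ofNat] at hn
  have hf (k : Fin 3 → ℤ) : 0 ≤ (1 + lapl k)⁻¹ := inv_nonneg.2 (by linarith [lapl_nonneg k])
  have hs : Summable fun k => (1 + lapl k)⁻¹ * ‖c k‖ :=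
    Real.summable_mul_of_Lp_Lq_of_nonneg (p := 2) (q := 2) Real.HolderConjugate.two_two
      hf (fun k => norm_nonneg _) (by simpa using summable_bessel_sq) (by simpa using hc)
  have h := Real.inner_le_Lp_mul_Lq_tsum_of_nonneg (p := 2) (q := 2) Real.HolderConjugate.two_two
    hf (fun k => norm_nonneg (c k)) (by simpa using summable_bessel_sq) (by simpa using hc)
  simp only [Real.rpow_ofNat, ← Real.sqrt_eq_rpow, ← hn, Real.sqrt_sq (norm_nonneg c)] at h
  exact ⟨hs, h⟩

theorem norm_mode_bessel_le (c : Seq) (k : Fin 3 → ℤ) :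
    ‖mode k (bessel c k)‖ ≤ (1 + lapl k)⁻¹ * ‖c k‖ := by
  refine (norm_mode_le _ _).trans ?_
  have := lapl_nonneg k
  rw [bessel_apply, norm_smul, norm_inv, Complex.norm_real, Real.norm_eq_abs,
    abs_of_nonneg (by positivity)]

theorem summable_mode_bessel (c : Seq) : Summable fun k => mode k (bessel c k) :=
  .of_norm_bounded (summable_bessel_mul c).1 (norm_mode_bessel_le c)

/-- The continuous function with the Fourier coefficients `(1 + 4π²|k|²)⁻¹ c k`. -/
def toBCF : Seq →L[ℝ] (E →ᵇ E) :=
  LinearMap.mkContinuous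
    { toFun := fun c => ∑' k, mode k (bessel c k)
      map_add' := fun c d => by
        rw [← (summable_mode_bessel c).tsum_add (summable_mode_bessel d)]
        simp only [map_add, lp.coeFn_add, Pi.add_apply]
      map_smul' := fun r c => by
        rw [RingHom.id_apply, ← (summable_mode_bessel c).tsum_const_smul]
        simp only [map_smul, lp.coeFn_smul, Pi.smul_apply] }
    (√(∑' k, ((1 + lapl k)⁻¹) ^ 2)) fun c =>
      (tsum_of_norm_bounded (summable_bessel_mul c).1.hasSum (norm_mode_bessel_le c)).trans
        (summable_bessel_mul c).2

theorem toL2_toBCF (c : Seq) : toL2 (toBCF c) = synth (bessel c) :=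
  (toL2.hasSum (summable_mode_bessel c).hasSum).unique (hasSum_synth (bessel c))

/-! ### The solution operator in `L²` -/

/-- The orthogonal projection onto the mean-free divergence-free fields. -/
def proj : L2Cell →L[ℝ] L2Cell := divFree.starProjection

theorem proj_mem (u : L2Cell) : proj u ∈ divFree := divFree.starProjection_apply_mem u

theorem proj_eq_self {u : L2Cell} (h : u ∈ divFree) : proj u = u :=
  Submodule.starProjection_eq_self_iff.2 h

theorem inner_proj_left (u v : L2Cell) : ⟪proj u, v⟫ = ⟪u, proj v⟫ :=
  divFree.inner_starProjection_left_eq_right u v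

/-- A function bounded below by a positive constant. -/
def IsCoer (α : E →ᵇ ℝ) : Prop := ∃ c > 0, ∀ y, c ≤ α y

theorem inner_mulL_self_ge {α : E →ᵇ ℝ} {c : ℝ} (h : ∀ y ∈ cell, c ≤ α y) (u : L2Cell) :
    c * ‖u‖ ^ 2 ≤ ⟪mulL α u, u⟫ := by
  rw [← real_inner_self_eq_norm_sq, ← real_inner_smul_left, L2.inner_def, L2.inner_def]
  refine integral_mono_ae (L2.integrable_inner (𝕜 := ℝ) (c • u) u)
    (L2.integrable_inner (𝕜 := ℝ) (mulL α u) u) ?_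
  filter_upwards [coeFn_mulL α u, Lp.coeFn_smul c u, ae_restrict_mem measurableSet_cell]
    with y h1 h2 hy
  rw [h1, h2, Pi.smul_apply, real_inner_smul_left, real_inner_smul_left]
  exact mul_le_mul_of_nonneg_right (h y hy) real_inner_self_nonneg

/-- The operator of the cell problem, extended by the identity on the orthogonal complement of
the divergence-free fields. -/
def cellOp (α : E →ᵇ ℝ) : L2Cell →L[ℝ] L2Cell := proj * mulL α * proj + (1 - proj)

/-- Lax–Milgram: the quadratic form is at least `c ‖proj u‖²` plus `‖u - proj u‖²`, hence coercive
with constant `min c 1`. -/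
theorem isUnit_cellOp {α : E →ᵇ ℝ} (h : IsCoer α) : IsUnit (cellOp α) := by
  obtain ⟨c, hc, hα⟩ := h
  refine ContinuousLinearMap.isUnit_of_forall_le_norm_inner_map (𝕜 := ℝ) _
    (c := (min c 1).toNNReal) (Real.toNNReal_pos.2 (lt_min hc one_pos)) fun u => ?_
  have h1 : ⟪cellOp α u, u⟫ = ⟪mulL α (proj u), proj u⟫ + ⟪u - proj u, u⟫ := by
    rw [cellOp]
    simp only [add_apply, mul_apply_eq_comp, sub_apply, one_apply_eq_self,
      inner_add_left, inner_proj_left]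
  have h2 : ⟪proj u, u⟫ = ‖proj u‖ ^ 2 := by
    rw [← real_inner_self_eq_norm_sq, ← inner_proj_left, proj_eq_self (proj_mem u)]
  have h3 : ⟪u - proj u, u⟫ = ‖u‖ ^ 2 - ‖proj u‖ ^ 2 := by
    rw [inner_sub_left, h2, real_inner_self_eq_norm_sq]
  have h4 := inner_mulL_self_ge (c := c) (fun y _ => hα y) (proj u)
  have h5 : ‖proj u‖ ^ 2 ≤ ‖u‖ ^ 2 :=
    pow_le_pow_left₀ (norm_nonneg _) (divFree.norm_starProjection_apply_le u) 2
  rw [Real.coe_toNNReal _ (lt_min hc one_pos).le]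
  refine le_trans ?_ (le_abs_self _)
  rw [h1, h3]
  nlinarith [min_le_left c 1, min_le_right c 1, sq_nonneg ‖proj u‖]

/-- The constant field `e r`. -/
def cst (r : Fin 3) : E →ᵇ E := BoundedContinuousFunction.const E (e r)

/-- The curl of the solution of the cell problem with the isotropic coefficient `α`. -/
def cellSol (r : Fin 3) (α : E →ᵇ ℝ) : L2Cell :=
  -(Ring.inverse (cellOp α)) (proj (mulL α (toL2 (cst r))))

theorem cellSol_spec (r : Fin 3) {α : E →ᵇ ℝ} (h : IsCoer α) :
    cellSol r α ∈ divFree ∧ ∀ v ∈ divFree, ⟪mulL α (toL2 (cst r) + cellSol r α), v⟫ = 0 := by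
  set w := cellSol r α with hw
  have h1 : cellOp α w = -proj (mulL α (toL2 (cst r))) := by
    rw [hw, cellSol, map_neg, ← mul_apply_eq_comp,
      Ring.mul_inverse_cancel _ (isUnit_cellOp h), one_apply_eq_self]
  have h2 : cellOp α w = proj (mulL α (proj w)) + (w - proj w) := rfl
  have h3 : proj w = w := by
    -- Projecting the equation removes `w - proj w`; comparison with the equation itself then forces
    -- this difference to vanish.
    have h4 := congrArg proj (h2.symm.trans h1)
    rw [map_add, map_sub, map_neg, proj_eq_self (proj_mem _), proj_eq_self (proj_mem _),
      proj_eq_self (proj_mem _), sub_self, add_zero] at h4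
    rw [h2, h4] at h1
    have := add_eq_left.1 h1
    exact (sub_eq_zero.1 this).symm
  refine ⟨h3 ▸ proj_mem w, fun v hv => ?_⟩
  rw [h2, h3, sub_self, add_zero] at h1
  rw [← proj_eq_self hv, ← inner_proj_left, map_add, map_add, h1, add_neg_cancel, inner_zero_left]

/-- The operator is affine in `α`, and inversion is smooth at units of a Banach algebra. -/
theorem contDiffAt_cellSol (r : Fin 3) {α : E →ᵇ ℝ} (h : IsCoer α) :
    ContDiffAt ℝ 1 (cellSol r) α := by
  have h1 : ContDiff ℝ 1 cellOp := by
    refine ContDiff.add ?_ contDiff_const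
    exact (contDiff_const.mul mulL.contDiff).mul contDiff_const
  obtain ⟨U, hU⟩ := isUnit_cellOp h
  have h2 : ContDiffAt ℝ 1 Ring.inverse (cellOp α) := hU ▸ contDiffAt_ringInverse ℝ U
  have h3 : ContDiffAt ℝ 1 (fun β => proj (mulL β (toL2 (cst r)))) α :=
    (proj.contDiff.comp (mulL.contDiff.clm_apply contDiff_const)).contDiffAt
  exact ((h2.comp α h1.contDiffAt).clm_apply h3).neg

/-! ### The first order system for the curl -/

theorem isUnit_of_isCoer {α : E →ᵇ ℝ} (h : IsCoer α) : IsUnit α := by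
  obtain ⟨c, hc, hα⟩ := h
  have h0 (y : E) : 0 < α y := hc.trans_le (hα y)
  refine IsUnit.of_mul_eq_one (BoundedContinuousFunction.ofNormedAddCommGroup (fun y => (α y)⁻¹)
    (α.continuous.inv₀ fun y => (h0 y).ne') c⁻¹ fun y => ?_) ?_
  · rw [norm_inv, Real.norm_eq_abs, abs_of_pos (h0 y)]
    exact inv_anti₀ hc (hα y)
  · ext y
    exact mul_inv_cancel₀ (h0 y).ne'

theorem inverse_apply {α : E →ᵇ ℝ} (h : IsCoer α) (y : E) : Ring.inverse α y = (α y)⁻¹ := by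
  have h1 := congrArg (fun f : E →ᵇ ℝ => f y) (Ring.mul_inverse_cancel α (isUnit_of_isCoer h))
  exact eq_inv_of_mul_eq_one_right h1

theorem IsC1Per.mul {a b : E →ᵇ ℝ} {a' b' : Fin 3 → E →ᵇ ℝ} (ha : IsC1Per a a')
    (hb : IsC1Per b b') : IsC1Per (a * b) (fun i => a' i * b + a * b' i) where
  deriv i y := by
    have := HasDerivAt.mul (ha.deriv i y) (hb.deriv i y)
    simp only [zero_smul, add_zero] at this
    exact this
  per n y := by
    change a (y + latticeVec n) * b (y + latticeVec n) = a y * b y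
    rw [ha.per n y, hb.per n y]

theorem IsC1Per.inverse {a : E →ᵇ ℝ} {a' : Fin 3 → E →ᵇ ℝ} (ha : IsC1Per a a') (h : IsCoer a) :
    IsC1Per (Ring.inverse a) (fun i => -(Ring.inverse a * Ring.inverse a * a' i)) where
  deriv i y := by
    have h0 : a y ≠ 0 := by
      obtain ⟨c, hc, hα⟩ := h
      exact (hc.trans_le (hα y)).ne'
    have h1 := HasDerivAt.fun_inv (ha.deriv i y) (by simpa using h0)
    have h2 : ⇑(Ring.inverse a) = fun y => (a y)⁻¹ := funext (inverse_apply h)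
    simp only [zero_smul, add_zero] at h1
    rw [HasLineDerivAt, h2]
    refine h1.congr_deriv ?_
    change _ = -(Ring.inverse a y * Ring.inverse a y * a' i y)
    rw [inverse_apply h]
    field_simp
  per n y := by rw [inverse_apply h, inverse_apply h, ha.per n y]

theorem mulL_crossL (b : E →ᵇ ℝ) (w : Fin 3 → ℝ) (u : L2Cell) :
    mulL b (crossL w u) = crossL w (mulL b u) := by
  refine Lp.ext ?_
  filter_upwards [coeFn_mulL b (crossL w u), coeFn_crossL w u, coeFn_crossL w (mulL b u),
    coeFn_mulL b u] with y h1 h2 h3 h4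
  rw [h1, h2, h3, h4, map_smul]

/-- The field `b × u`, where `b` is a bounded continuous vector field. -/
def crossMul (b : Fin 3 → E →ᵇ ℝ) (u : L2Cell) : L2Cell := ∑ j, mulL (b j) (crossL (unitFam j) u)

theorem isC1Per_cst (r : Fin 3) : IsC1Per (cst r) (fun _ => 0) :=
  ⟨fun _ _ => hasDerivAt_const _ _, fun _ _ => rfl⟩

/-- The sum is the curl of `f`; this supplies the test fields for the first order system. -/
theorem sum_crossL_mem_divFree {f : E →ᵇ E} {f' : Fin 3 → E →ᵇ E} (h : IsC1Per f f') :
    ∑ j, crossL (unitFam j) (toL2 (f' j)) ∈ divFree := by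
  refine mem_divFree_of_coef (fun k => coef k (toL2 f)) fun k => ?_
  rw [map_sum, crossC_eq_sum]
  refine Finset.sum_congr rfl fun j _ => ?_
  rw [coef_crossL, coef_deriv h]

/-- If `α u` is orthogonal to the divergence-free fields, then `curl u = - (∇α / α) × u`. -/
theorem crossC_coef_of_orthogonal {α : E →ᵇ ℝ} {α' : Fin 3 → E →ᵇ ℝ} (hα : IsC1Per α α')
    (hc : IsCoer α) {u : L2Cell} (hu : ∀ v ∈ divFree, ⟪mulL α u, v⟫ = 0) (k : Fin 3 → ℤ) :
    crossC (freq k) (coef k u) = -coef k (crossMul (fun j => Ring.inverse α * α' j) u) := by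
  refine ext_inner_right ℝ fun v => ?_
  rw [inner_neg_left, ← crossC_conj_freq, inner_coef, inner_coef, eq_neg_iff_add_eq_zero]
  have hmul := Ring.mul_inverse_cancel α (isUnit_of_isCoer hc)
  -- The test field is the curl of `α⁻¹ m` for a mode `m`. Its factor `α⁻¹` cancels the `α` of `α
  -- u`, leaving `curl m - (∇α / α) × m` paired with `u`.
  have h0 := hu _ (sum_crossL_mem_divFree ((hα.inverse hc).smul (isC1Per_mode k v)))
  rw [inner_sum] at h0
  rw [← h0, crossC_eq_sum, map_sum, map_sum, inner_sum, crossMul, sum_inner,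
    ← Finset.sum_add_distrib]
  refine Finset.sum_congr rfl fun j _ => ?_
  rw [map_add, map_add, inner_add_right, add_comm, ← mulL_toL2, ← mulL_toL2, inner_mulL α,
    inner_mulL α, mulL_crossL α, mulL_crossL α, ← mulL_mul, ← mulL_mul, hmul, mulL_one,
    crossL_toL2_mode]
  congr 1
  have h1 : α * -(Ring.inverse α * Ring.inverse α * α' j) = -(Ring.inverse α * α' j) := by
    calc _ = -(α * Ring.inverse α * (Ring.inverse α * α' j)) := by ring
      _ = _ := by rw [hmul, one_mul]
  rw [h1, map_neg, neg_apply, map_neg, inner_neg_right, mulL_crossL, inner_crossL, inner_mulL,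
    ← mulL_crossL, mulL_crossL]

/-- This is `curl curl = ∇ div - Δ` on one frequency; the sign comes from the frequencies being
imaginary. -/
theorem crossC_crossC {k : Fin 3 → ℤ} {v : C3} (h : ∑ j, freq k j * v j = 0) :
    crossC (freq k) (crossC (freq k) v) = (lapl k : ℂ) • v := by
  have h1 (j : Fin 3) : ((‖freq k j‖ ^ 2 : ℝ) : ℂ) = -(freq k j * freq k j) := by
    rw [← Complex.normSq_eq_norm_sq, Complex.normSq_eq_conj_mul_self, conj_freq, neg_mul]
  have h2 : (lapl k : ℂ) = -(∑ j, freq k j * freq k j) := by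
    rw [lapl, Complex.ofReal_sum, ← Finset.sum_neg_distrib]
    exact Finset.sum_congr rfl fun j _ => h1 j
  rw [h2]
  rw [Fin.sum_univ_three] at *
  ext i
  fin_cases i
  · simp [crossC_apply]; linear_combination freq k 0 * h
  · simp [crossC_apply]; linear_combination freq k 1 * h
  · simp [crossC_apply]; linear_combination freq k 2 * h

theorem inv_lapl_smul_crossC_crossC {w : L2Cell} (hw : w ∈ divFree) (k : Fin 3 → ℤ) :
    (lapl k : ℂ)⁻¹ • crossC (freq k) (crossC (freq k) (coef k w)) = coef k w := by
  rw [crossC_crossC (hw.2 k)]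
  -- At frequency zero the inverse is `0` by convention, and the mean of `w` is zero as well.
  by_cases h : lapl k = 0
  · rw [lapl_eq_zero h, hw.1, smul_zero, smul_zero]
  · exact inv_smul_smul₀ (by exact_mod_cast h) _

/-! ### Regularity of the solution -/

theorem PerC2.isC1Per (p : PerC2) : IsC1Per p.1.1 p.1.2.1 :=
  ⟨p.2.1, isPer_of_unit p.2.2.2⟩

theorem PerC2.isC1Per_deriv (p : PerC2) (i : Fin 3) : IsC1Per (p.1.2.1 i) (p.1.2.2 i) :=
  ⟨p.2.2.1 i, hasLineDerivAt_isPer ((PerC2.isC1Per p).deriv i) (PerC2.isC1Per p).per⟩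

/-- The logarithmic derivative `∂ⱼα / α`. -/
def logDeriv (p : PerC2) (j : Fin 3) : E →ᵇ ℝ := Ring.inverse p.1.1 * p.1.2.1 j

/-- The derivative `∂ᵢ(∂ⱼα / α)`. -/
def logDeriv₂ (p : PerC2) (j i : Fin 3) : E →ᵇ ℝ :=
  -(Ring.inverse p.1.1 * Ring.inverse p.1.1 * p.1.2.1 i) * p.1.2.1 j +
    Ring.inverse p.1.1 * p.1.2.2 j i

theorem isC1Per_logDeriv {p : PerC2} (h : IsCoer p.1.1) (j : Fin 3) :
    IsC1Per (logDeriv p j) (logDeriv₂ p j) := ((PerC2.isC1Per p).inverse h).mul (PerC2.isC1Per_deriv p j)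

/-- The field `e r + curl N`. -/
def total (r : Fin 3) (p : PerC2) : L2Cell := toL2 (cst r) + cellSol r p.1.1

/-- The field `(∇α / α) × (e r + curl N)`. -/
def source (r : Fin 3) (p : PerC2) : L2Cell := crossMul (logDeriv p) (total r p)

/-- The partial derivative `∂ᵢ` of the field `curl N`. -/
def solPartial (r : Fin 3) (p : PerC2) (i : Fin 3) : L2Cell :=
  -synth (partialPotential i (fourierSeq (source r p)))

/-- The partial derivative `∂ᵢ` of the field `source r p`. -/
def sourcePartial (r : Fin 3) (p : PerC2) (i : Fin 3) : L2Cell :=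
  ∑ j, (mulL (logDeriv₂ p j i) (crossL (unitFam j) (total r p)) +
    mulL (logDeriv p j) (crossL (unitFam j) (solPartial r p i)))

/-- The Fourier coefficients of `(1 - Δ) curl N`. -/
def besselSeq (r : Fin 3) (p : PerC2) : Seq :=
  -potential (fourierSeq (source r p)) +
    ∑ i, partialPotential i (fourierSeq (sourcePartial r p i))

/-- The constant `e r` has no curl, so the first order system gives the curl of `w` itself. A field
in `divFree` is recovered from its curl by `curl (-Δ)⁻¹`. -/
theorem coef_cellSol (r : Fin 3) {p : PerC2} (h : IsCoer p.1.1) (k : Fin 3 → ℤ) :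
    coef k (cellSol r p.1.1) = -potential (fourierSeq (source r p)) k := by
  obtain ⟨h1, h2⟩ := cellSol_spec r h
  have h3 := crossC_coef_of_orthogonal (PerC2.isC1Per p) h h2 k
  have h4 : crossC (freq k) (coef k (toL2 (cst r))) = 0 := by
    rw [crossC_eq_sum]
    refine Finset.sum_eq_zero fun j _ => ?_
    rw [← coef_deriv (isC1Per_cst r), map_zero, map_zero, map_zero]
  rw [map_add, map_add, h4, zero_add] at h3
  rw [potential_apply, ← inv_lapl_smul_crossC_crossC h1, h3, map_neg, smul_neg]
  rfl

theorem cellSol_eq (r : Fin 3) {p : PerC2} (h : IsCoer p.1.1) :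
    cellSol r p.1.1 = synth (-potential (fourierSeq (source r p))) := by
  rw [← synth_fourierSeq (cellSol r p.1.1)]
  congr 1
  ext1
  funext k
  exact coef_cellSol r h k

/-- First gain of regularity: `∂ᵢ curl (-Δ)⁻¹` has order zero, so a square integrable source already
gives square integrable derivatives. -/
theorem hasPartial_total (r : Fin 3) {p : PerC2} (h : IsCoer p.1.1) (i : Fin 3) :
    HasPartial i (total r p) (solPartial r p i) := by
  have h1 : HasPartial i (toL2 (cst r)) 0 := by
    have h3 := (isC1Per_cst r).hasPartial i
    rwa [map_zero] at h3
  have h2 : HasPartial i (cellSol r p.1.1) (solPartial r p i) := by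
    have h3 : solPartial r p i = synth (-partialPotential i (fourierSeq (source r p))) :=
      (map_neg synth _).symm
    rw [cellSol_eq r h, h3]
    refine hasPartial_synth fun k => ?_
    simp only [lp.coeFn_neg, Pi.neg_apply, partialPotential_apply, smul_neg]
  have h3 := h1.add h2
  rwa [zero_add] at h3

theorem hasPartial_source (r : Fin 3) {p : PerC2} (h : IsCoer p.1.1) (i : Fin 3) :
    HasPartial i (source r p) (sourcePartial r p i) :=
  HasPartial.sum fun j _ => ((hasPartial_total r h i).crossL _).mulL (isC1Per_logDeriv h j)

/-- Second gain: in `-Δ w = ∑ᵢ ∂ᵢ² curl (-Δ)⁻¹ s` one `∂ᵢ` is moved onto the source `s`, which is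
differentiable by the first gain. Each summand is then a bounded operator applied to an `L²` field.
-/
theorem bessel_besselSeq (r : Fin 3) {p : PerC2} (h : IsCoer p.1.1) :
    bessel (besselSeq r p) = fourierSeq (cellSol r p.1.1) := by
  ext1
  funext k
  rw [bessel_apply, fourierSeq_apply, coef_cellSol r h]
  have hne : ((1 + lapl k : ℝ) : ℂ) ≠ 0 := by
    have := lapl_nonneg k
    exact_mod_cast (by positivity : (1 + lapl k) ≠ 0)
  rw [inv_smul_eq_iff₀ hne]
  have h2 : (lapl k : ℂ) = -(∑ j, freq k j * freq k j) := by
    rw [lapl, Complex.ofReal_sum, ← Finset.sum_neg_distrib]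
    refine Finset.sum_congr rfl fun j _ => ?_
    rw [← Complex.normSq_eq_norm_sq, Complex.normSq_eq_conj_mul_self, conj_freq, neg_mul]
  have h3 (i : Fin 3) : partialPotential i (fourierSeq (sourcePartial r p i)) k =
      (freq k i * freq k i) • potential (fourierSeq (source r p)) k := by
    rw [partialPotential_apply, potential_apply, potential_apply, fourierSeq_apply,
      fourierSeq_apply, hasPartial_source r h i k, crossC_smul, smul_comm _ (freq k i), smul_smul]
  rw [besselSeq, lp.coeFn_add, Pi.add_apply, lp.coeFn_sum, Finset.sum_apply, lp.coeFn_neg,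
    Pi.neg_apply]
  simp_rw [h3]
  rw [← Finset.sum_smul, Complex.ofReal_add, Complex.ofReal_one, h2]
  module

/-! ### Smooth dependence on the coefficient -/

theorem contDiff_coe_PerC2 : ContDiff ℝ 1 fun q : PerC2 => q.1 := by
  have h : ContDiff ℝ 1 PerC2.subtypeₗᵢ := LinearIsometry.contDiff _
  exact h

theorem contDiffAt_inverse {p : PerC2} (h : IsCoer p.1.1) :
    ContDiffAt ℝ 1 (fun q : PerC2 => Ring.inverse q.1.1) p := by
  obtain ⟨U, hU⟩ := isUnit_of_isCoer h
  have h2 : ContDiffAt ℝ 1 Ring.inverse p.1.1 := hU ▸ contDiffAt_ringInverse ℝ U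
  exact h2.comp p contDiff_coe_PerC2.fst.contDiffAt

theorem contDiff_deriv (j : Fin 3) : ContDiff ℝ 1 fun q : PerC2 => q.1.2.1 j :=
  contDiff_pi.1 contDiff_coe_PerC2.snd.fst j

theorem contDiff_deriv₂ (j i : Fin 3) : ContDiff ℝ 1 fun q : PerC2 => q.1.2.2 j i :=
  contDiff_pi.1 (contDiff_pi.1 contDiff_coe_PerC2.snd.snd j) i

theorem contDiffAt_logDeriv {p : PerC2} (h : IsCoer p.1.1) (j : Fin 3) :
    ContDiffAt ℝ 1 (fun q => logDeriv q j) p :=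
  (contDiffAt_inverse h).mul (contDiff_deriv j).contDiffAt

theorem contDiffAt_logDeriv₂ {p : PerC2} (h : IsCoer p.1.1) (j i : Fin 3) :
    ContDiffAt ℝ 1 (fun q => logDeriv₂ q j i) p :=
  ((((contDiffAt_inverse h).mul (contDiffAt_inverse h)).mul
    (contDiff_deriv i).contDiffAt).neg.mul (contDiff_deriv j).contDiffAt).add
    ((contDiffAt_inverse h).mul (contDiff_deriv₂ j i).contDiffAt)

theorem contDiffAt_mulL_crossL {b : PerC2 → E →ᵇ ℝ} {u : PerC2 → L2Cell} {p : PerC2}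
    (hb : ContDiffAt ℝ 1 b p) (hu : ContDiffAt ℝ 1 u p) (w : Fin 3 → ℝ) :
    ContDiffAt ℝ 1 (fun q => mulL (b q) (crossL w (u q))) p :=
  (mulL.contDiff.contDiffAt.comp p hb).clm_apply ((crossL w).contDiff.contDiffAt.comp p hu)

theorem contDiffAt_total (r : Fin 3) {p : PerC2} (h : IsCoer p.1.1) :
    ContDiffAt ℝ 1 (total r) p :=
  contDiffAt_const.add (ContDiffAt.comp (g := cellSol r) (f := fun q : PerC2 => q.1.1) p
    (contDiffAt_cellSol r h) contDiff_coe_PerC2.fst.contDiffAt)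

theorem contDiffAt_source (r : Fin 3) {p : PerC2} (h : IsCoer p.1.1) :
    ContDiffAt ℝ 1 (fun q => source r q) p := by
  unfold source crossMul
  exact
  ContDiffAt.sum fun j _ => contDiffAt_mulL_crossL (contDiffAt_logDeriv h j)
    (contDiffAt_total r h) _

theorem contDiffAt_solPartial (r : Fin 3) {p : PerC2} (h : IsCoer p.1.1) (i : Fin 3) :
    ContDiffAt ℝ 1 (fun q => solPartial r q i) p :=
  ((synth.comp ((partialPotential i).comp
    fourierSeq.toContinuousLinearMap)).contDiff.contDiffAt.comp p (contDiffAt_source r h)).neg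

theorem contDiffAt_sourcePartial (r : Fin 3) {p : PerC2} (h : IsCoer p.1.1) (i : Fin 3) :
    ContDiffAt ℝ 1 (fun q => sourcePartial r q i) p :=
  ContDiffAt.sum fun j _ => (contDiffAt_mulL_crossL (contDiffAt_logDeriv₂ h j i)
    (contDiffAt_total r h) _).add
    (contDiffAt_mulL_crossL (contDiffAt_logDeriv h j) (contDiffAt_solPartial r h i) _)

theorem contDiffAt_besselSeq (r : Fin 3) {p : PerC2} (h : IsCoer p.1.1) :
    ContDiffAt ℝ 1 (besselSeq r) p :=
  ((potential.comp fourierSeq.toContinuousLinearMap).contDiff.contDiffAt.comp p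
    (contDiffAt_source r h)).neg.add <| ContDiffAt.sum fun i _ =>
      ((partialPotential i).comp fourierSeq.toContinuousLinearMap).contDiff.contDiffAt.comp p
        (contDiffAt_sourcePartial r h i)

/-! ### Composition with differentiable maps -/

/-- Chain rule. Smoothness of `G` is required also at boundary values, so that `fderiv ℝ G` stays
continuous along `u` up to the boundary. -/
theorem IsC1Closure.comp {X Z : Type*} [NormedAddCommGroup X] [NormedSpace ℝ X]
    [NormedAddCommGroup Z] [NormedSpace ℝ Z] {D : Set E} {u : E → X} (hu : IsC1Closure D u)
    {G : X → Z} (hG : ∀ x ∈ closure D, ContDiffAt ℝ 1 G (u x)) :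
    IsC1Closure D fun x => G (u x) := by
  obtain ⟨hc, u', hc', hd⟩ := hu
  refine ⟨fun x hx => (hG x hx).continuousAt.comp_continuousWithinAt (hc x hx),
    fun x => (fderiv ℝ G (u x)).comp (u' x), fun x hx => ?_, fun x hx => ?_⟩
  · have h1 : ContinuousAt (fderiv ℝ G) (u x) :=
      ((hG x hx).fderiv_right (m := 0) (by simp)).continuousAt
    exact (h1.comp_continuousWithinAt (hc x hx)).clm_comp (hc' x hx)
  · exact ((hG x (subset_closure hx)).differentiableAt (by simp)).hasFDerivAt.comp x (hd x hx)

/-- Restriction of bounded continuous fields to the closed cube. -/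
def restrictCell : (E →ᵇ E) →L[ℝ] C(closedCell, E) :=
  LinearMap.mkContinuous
    { toFun := fun f => f.toContinuousMap.restrict closedCell
      map_add' := fun f g => rfl
      map_smul' := fun c f => rfl } 1 fun f => by
    rw [one_mul]
    exact (ContinuousMap.norm_le _ (norm_nonneg f)).2 fun y => f.norm_coe_le_norm y

theorem memC1C_toBCF {D : Set E} {d : E → Seq} (hd : IsC1Closure D d) :
    MemC1C D fun x y => toBCF (d x) y :=
  ⟨fun x => restrictCell (toBCF (d x)),
    hd.comp (G := restrictCell.comp toBCF) fun _ _ =>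
      (restrictCell.comp toBCF).contDiff.contDiffAt, fun _ _ _ => rfl⟩

theorem contDiff_toH2 : ContDiff ℝ 1 toH2 := toH2.contDiff

theorem memC1H2_toBCF {D : Set E} {d : E → Seq} (hd : IsC1Closure D d) :
    MemC1H2 D fun x y => toBCF (d x) y :=
  ⟨fun x => toH2 (d x), hd.comp fun _ _ => contDiff_toH2.contDiffAt, fun x _ => by
    rw [coe_toH2, ← toL2_toBCF]
    exact coeFn_toL2 _⟩

/-! ### The vector potential -/

theorem bessel_potential (c : Seq) : bessel (potential c) = potential (bessel c) := by
  ext1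
  funext k
  rw [bessel_apply, potential_apply, potential_apply, bessel_apply, crossC_smul, smul_comm]

/-- Together with `mem_divFree_of_isPerWeakCurl` this shows that `divFree` is exactly the range of
the curl. -/
theorem isPerWeakCurl_potential {w : L2Cell} (hw : w ∈ divFree) :
    IsPerWeakCurl (synth (potential (fourierSeq w))) w := by
  have h := isPerWeakCurl_synth (c := potential (fourierSeq w)) (d := fourierSeq w) fun k => by
    rw [potential_apply, crossC_smul, fourierSeq_apply, inv_lapl_smul_crossC_crossC hw]
  rwa [synth_fourierSeq] at h

theorem isPerDivFree_potential (c : Seq) : IsPerDivFree (synth (potential c)) :=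
  isPerDivFree_synth fun k => by
    have h := sum_freq_mul_crossC k (c k)
    simp only [potential_apply, PiLp.smul_apply, smul_eq_mul, mul_left_comm _ (lapl k : ℂ)⁻¹]
    rw [← Finset.mul_sum, h, mul_zero]

theorem integral_potential (c : Seq) : ∫ y in cell, synth (potential c) y = 0 :=
  integral_synth_eq_zero (by rw [potential_apply, freq_zero, crossC_zero, smul_zero])

theorem IsPerDivFree.congr {u v : E → E} (h : IsPerDivFree u) (huv : u =ᵐ[cellMeasure] v) :
    IsPerDivFree v := fun φ hφ hc => by
  rw [← h φ hφ hc]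
  refine integral_congr_ae ?_
  filter_upwards [perExt_congr huv] with y hy
  rw [hy]

/-! ### Uniqueness -/

theorem HTilde.curl_mk (p : HCurlPer) : HTilde.curl (HTilde.mk p) = p.1.2 := rfl

theorem HTilde.curl_mem_divFree (t : HTilde) : HTilde.curl t ∈ divFree := by
  obtain ⟨p, rfl⟩ := (LinearMap.ker curlMap).mkQ_surjective t
  exact mem_divFree_of_isPerWeakCurl p.2

theorem HTilde.isometry_curl : Isometry HTilde.curl :=
  AddMonoidHomClass.isometry_of_norm HTilde.curl fun _ => rfl

theorem toEuclideanLin_smul_one (c : ℝ) (v : E) :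
    (c • (1 : Matrix (Fin 3) (Fin 3) ℝ)).toEuclideanLin v = c • v := by
  ext i
  simp

theorem ae_eq_of_isCellSolution {D : Set E} (hD : IsOpen D)
    {a : E → E → Matrix (Fin 3) (Fin 3) ℝ} {r : Fin 3} {α : E → E →ᵇ ℝ} (hα : ContinuousOn α D)
    (haα : ∀ x ∈ D, ∀ y ∈ cell, a x y = α x y • (1 : Matrix (Fin 3) (Fin 3) ℝ))
    {c : ℝ} (hc : 0 < c) (hcα : ∀ x ∈ D, ∀ y ∈ cell, c ≤ α x y)
    {N : Lp HTilde 2 (volume.restrict D)} (hN : IsCellSolution D a (e r) N)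
    {M : E → HTilde} (hM : ContinuousOn M D)
    (hsol : ∀ x ∈ D, ∀ v ∈ divFree, ⟪mulL (α x) (toL2 (cst r) + HTilde.curl (M x)), v⟫ = 0) :
    ∀ᵐ x ∂(volume.restrict D), N x = M x := by
  -- Neither `D` nor `M` nor `α` need be bounded. On these open sets, which exhaust `D`, all three
  -- are, so `N - M` restricted to them is an admissible test function.
  let S (n : ℕ) : Set E :=
    (D ∩ M ⁻¹' Metric.ball 0 n) ∩ (D ∩ α ⁻¹' Metric.ball 0 n) ∩ Metric.ball 0 n
  have hSo (n : ℕ) : IsOpen (S n) := ((hM.isOpen_inter_preimage hD Metric.isOpen_ball).inter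
    (hα.isOpen_inter_preimage hD Metric.isOpen_ball)).inter Metric.isOpen_ball
  have key (n : ℕ) : ∀ᵐ x ∂(volume.restrict D), x ∈ S n → N x = M x := by
    have hMm : AEStronglyMeasurable M (volume.restrict D) := hM.aestronglyMeasurable hD.measurableSet
    have hv : MemLp ((S n).indicator fun x => N x - M x) 2 (volume.restrict D) := by
      rw [memLp_indicator_iff_restrict (hSo n).measurableSet]
      refine ((Lp.memLp N).restrict _).sub ?_
      have : IsFiniteMeasure ((volume.restrict D).restrict (S n)) := ⟨by
        rw [Measure.restrict_apply_univ]
        refine (Measure.restrict_apply_le _ _).trans_lt ?_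
        exact (measure_mono inter_subset_right).trans_lt measure_ball_lt_top⟩
      refine MemLp.of_bound hMm.restrict n ?_
      filter_upwards [ae_restrict_mem (hSo n).measurableSet] with x hx
      exact (mem_ball_zero_iff.1 hx.1.1.2).le
    have h0 := hN hv.toLp
    let V : Lp HTilde 2 (volume.restrict D) := hv.toLp
    have hVS : ∀ᵐ x ∂(volume.restrict D), V x = (S n).indicator (fun x => N x - M x) x :=
      hv.coeFn_toLp
    let h (x : E) : ℝ := ⟪mulL (α x) (HTilde.curl (V x)), HTilde.curl (V x)⟫
    have h1 : (fun x => ∫ y in cell, ⟪(a x y).toEuclideanLin (e r + HTilde.curl (N x) y),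
        HTilde.curl (V x) y⟫) =ᵐ[volume.restrict D] h := by
      filter_upwards [hVS, ae_restrict_mem hD.measurableSet] with x hx hxD
      have h2 : ∫ y in cell, ⟪(a x y).toEuclideanLin (e r + HTilde.curl (N x) y),
          HTilde.curl (V x) y⟫ =
            ⟪mulL (α x) (toL2 (cst r) + HTilde.curl (N x)), HTilde.curl (V x)⟫ := by
        rw [L2.inner_def]
        refine integral_congr_ae ?_
        filter_upwards [coeFn_mulL (α x) (toL2 (cst r) + HTilde.curl (N x)),
          Lp.coeFn_add (toL2 (cst r)) (HTilde.curl (N x)), coeFn_toL2 (cst r),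
          ae_restrict_mem measurableSet_cell] with y h3 h4 h5 hy
        rw [h3, h4, Pi.add_apply, h5, haα x hxD y hy, toEuclideanLin_smul_one]
        rfl
      rw [h2]
      by_cases hxS : x ∈ S n
      · rw [indicator_of_mem hxS] at hx
        -- On `S n` the test function equals `N - M`; subtracting the pointwise equation of `M`
        -- leaves the quadratic form of the difference.
        have h3 : toL2 (cst r) + HTilde.curl (N x) =
            (toL2 (cst r) + HTilde.curl (M x)) + HTilde.curl (V x) := by
          rw [hx, map_sub]
          abel
        rw [h3, map_add, inner_add_left, hsol x hxD _ (HTilde.curl_mem_divFree _), zero_add]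
      · rw [indicator_of_notMem hxS] at hx
        simp [h, hx]
    have h2 : ∫ x in D, h x = 0 := by
      rw [← integral_congr_ae h1]
      exact h0
    have hge : ∀ x ∈ D, c * ‖V x‖ ^ 2 ≤ h x := fun x hx =>
      inner_mulL_self_ge (hcα x hx) (HTilde.curl (V x))
    have hpos : 0 ≤ᵐ[volume.restrict D] h := by
      filter_upwards [ae_restrict_mem hD.measurableSet] with x hx
      exact le_trans (by positivity) (hge x hx)
    have hcurl : AEStronglyMeasurable (fun x => HTilde.curl (V x)) (volume.restrict D) :=
      HTilde.isometry_curl.continuous.comp_aestronglyMeasurable (Lp.aestronglyMeasurable V)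
    have hint : Integrable h (volume.restrict D) := by
      refine Integrable.mono' (g := fun x => ‖mulL‖ * n * ‖V x‖ ^ 2)
        ((Lp.memLp V).norm.integrable_sq.const_mul _) ?_ ?_
      · refine AEStronglyMeasurable.inner ?_ hcurl
        have hm := mulL.continuous.comp_aestronglyMeasurable
          (hα.aestronglyMeasurable (μ := volume) hD.measurableSet)
        exact isBoundedBilinearMap_apply.continuous.comp_aestronglyMeasurable (hm.prodMk hcurl)
      · filter_upwards [hVS] with x hx
        by_cases hxS : x ∈ S n
        · have h3 : ‖α x‖ ≤ n := (mem_ball_zero_iff.1 hxS.1.2.2).le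
          have h4 : ‖mulL (α x) (HTilde.curl (V x))‖ ≤ ‖mulL‖ * n * ‖V x‖ := by
            refine (mulL.le_opNorm₂ _ _).trans ?_
            change ‖mulL‖ * ‖α x‖ * ‖V x‖ ≤ _
            gcongr
          refine (norm_inner_le_norm _ _).trans ?_
          rw [sq, ← mul_assoc]
          exact mul_le_mul_of_nonneg_right h4 (norm_nonneg _)
        · rw [indicator_of_notMem hxS] at hx
          simp [h, hx]
    have h3 := (integral_eq_zero_iff_of_nonneg_ae hpos hint).1 h2
    filter_upwards [h3, hVS, ae_restrict_mem hD.measurableSet] with x hx hxV hxD hxS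
    have h4 := hge x hxD
    rw [hx, Pi.zero_apply] at h4
    have h5 : ‖V x‖ ^ 2 = 0 := le_antisymm (by nlinarith) (by positivity)
    rw [indicator_of_mem hxS] at hxV
    rw [sq_eq_zero_iff, norm_eq_zero, hxV, sub_eq_zero] at h5
    exact h5
  filter_upwards [ae_all_iff.2 key, ae_restrict_mem hD.measurableSet] with x hx hxD
  obtain ⟨n, hn⟩ := exists_nat_gt (max ‖M x‖ (max ‖α x‖ ‖x‖))
  refine hx n ⟨⟨⟨hxD, ?_⟩, hxD, ?_⟩, ?_⟩
  · exact mem_ball_zero_iff.2 ((le_max_left _ _).trans_lt hn)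
  · exact mem_ball_zero_iff.2
      (((le_max_left _ _).trans (le_max_right _ _)).trans_lt hn)
  · exact mem_ball_zero_iff.2
      (((le_max_right _ _).trans (le_max_right _ _)).trans_lt hn)

/-! ### Bounds up to the boundary -/

/-- The translates of the open cube are dense, so periodicity and continuity suffice. -/
theorem le_of_forall_cell {α : E →ᵇ ℝ} (hp : IsPer α) {c : ℝ} (h : ∀ y ∈ cell, c ≤ α y) (y : E) :
    c ≤ α y := by
  have hd : Dense {y : E | cellFract y ∈ cell} :=
    Measure.dense_of_ae ae_cellFract_mem
  have hcl : IsClosed {y : E | c ≤ α y} := isClosed_le continuous_const α.continuous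
  have hsub : {y : E | cellFract y ∈ cell} ⊆ {y : E | c ≤ α y} := fun y hy => by
    have := h _ hy
    rwa [hp.cellFract] at this
  exact hcl.closure_subset_iff.2 hsub (hd y)

theorem le_of_forall_mem {D : Set E} {F : E → PerC2} (hF : ContinuousOn F (closure D)) {c : ℝ}
    (h : ∀ x ∈ D, ∀ y ∈ cell, c ≤ (F x).1.1 y) : ∀ x ∈ closure D, ∀ y, c ≤ (F x).1.1 y := by
  intro x hx y
  have h1 : ContinuousOn (fun x => (F x).1.1 y) (closure D) :=
    (BoundedContinuousFunction.evalCLM ℝ y).continuous.comp_continuousOn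
      (contDiff_coe_PerC2.continuous.comp_continuousOn hF).fst
  have : (nhdsWithin x D).NeBot := mem_closure_iff_nhdsWithin_neBot.1 hx
  refine ge_of_tendsto (x := nhdsWithin x D) (f := fun x => (F x).1.1 y)
    ((h1 x hx).mono subset_closure) ?_
  filter_upwards [self_mem_nhdsWithin] with z hz
  exact le_of_forall_cell (PerC2.isC1Per (F z)).per (h z hz) y

theorem eq_smul_one {A : Matrix (Fin 3) (Fin 3) ℝ} (h : ∃ α : ℝ, A = α • 1) :
    A = A 0 0 • (1 : Matrix (Fin 3) (Fin 3) ℝ) := by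
  obtain ⟨α, rfl⟩ := h
  simp

end CurlCell

end

/-! ### The main theorem -/

open CurlCell
theorem mainTheorem5 (D : Set E) (hD : IsOpen D)
    (a : E → E → Matrix (Fin 3) (Fin 3) ℝ) (c₁ c₂ : ℝ) (hc₁ : 0 < c₁) (hc₂ : 0 < c₂)
    (hcoer : ∀ x ∈ D, ∀ y ∈ cell, ∀ ξ : E,
      c₁ * ‖ξ‖ ^ 2 ≤ inner ℝ ((a x y).toEuclideanLin ξ) ξ)
    (hbdd : ∀ x ∈ D, ∀ y ∈ cell, ∀ ξ ζ : E,
      inner ℝ ((a x y).toEuclideanLin ξ) ζ ≤ c₂ * ‖ξ‖ * ‖ζ‖)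
    (hreg : ∀ i j : Fin 3, MemC1C2Per D (fun x y => a x y i j))
    (hiso : ∀ x ∈ D, ∀ y ∈ cell, ∃ α : ℝ, a x y = α • (1 : Matrix (Fin 3) (Fin 3) ℝ))
    (r : Fin 3) (N : Lp HTilde 2 (volume.restrict D)) (hN : IsCellSolution D a (e r) N) :
    ∃ (W N' : E → E → E) (n : E → HCurlPer),
      -- `W` is the curl of the solution
      (∀ᵐ x ∂(volume.restrict D), HTilde.curl (N x) =ᵐ[cellMeasure] W x) ∧
      MemC1C D W ∧ MemC1H2 D W ∧
      -- `N'` is a version of the solution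
      (∀ x ∈ D, (n x).1.1 =ᵐ[cellMeasure] N' x ∧ (n x).1.2 =ᵐ[cellMeasure] W x) ∧
      (∀ᵐ x ∂(volume.restrict D), HTilde.mk (n x) = N x) ∧
      (∀ x ∈ D, IsPerDivFree (N' x) ∧ ∫ y in cell, N' x y = 0) ∧
      MemC1C D N' ∧ MemC1H2 D N' := by
  -- By isotropy the scalar `α` is the first diagonal entry of `a`.
  obtain ⟨F, hF, hFa⟩ := hreg 0 0
  have haF : ∀ x ∈ D, ∀ y ∈ cell, a x y = (F x).1.1 y • (1 : Matrix (Fin 3) (Fin 3) ℝ) :=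
    fun x hx y hy => by
      rw [← hFa x hx y]
      exact eq_smul_one (hiso x hx y hy)
  have hge : ∀ x ∈ D, ∀ y ∈ cell, c₁ ≤ (F x).1.1 y := fun x hx y hy => by
    have h := hcoer x hx y hy (e 0)
    have h1 : ‖e 0‖ = 1 := by simp [e]
    rwa [haF x hx y hy, toEuclideanLin_smul_one, real_inner_smul_left, real_inner_self_eq_norm_sq,
      h1, one_pow, mul_one, mul_one] at h
  -- The lower bound passes to the closure by continuity; differentiability of `besselSeq r` is
  -- needed at boundary values too.
  have hco : ∀ x ∈ closure D, IsCoer (F x).1.1 := fun x hx =>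
    ⟨c₁, hc₁, le_of_forall_mem hF.1 hge x hx⟩
  have hcoD : ∀ x ∈ D, IsCoer (F x).1.1 := fun x hx => hco x (subset_closure hx)
  have hd : IsC1Closure D fun x => besselSeq r (F x) :=
    hF.comp fun x hx => contDiffAt_besselSeq r (hco x hx)
  have hd' : IsC1Closure D fun x => potential (besselSeq r (F x)) :=
    hd.comp fun x _ => potential.contDiff.contDiffAt
  let w (x : E) : L2Cell := cellSol r (F x).1.1
  have hw : ∀ x ∈ D, w x ∈ divFree := fun x hx => (cellSol_spec r (hcoD x hx)).1
  classical
  -- Membership of `w x` in `divFree` is known for `x ∈ D` only; elsewhere the value is irrelevant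
  -- and set to `0`.
  let n (x : E) : HCurlPer := if h : w x ∈ divFree then
    ⟨(synth (potential (fourierSeq (w x))), w x), isPerWeakCurl_potential h⟩ else 0
  have hn : ∀ x ∈ D, (n x).1 = (synth (potential (fourierSeq (w x))), w x) := fun x hx => by
    simp only [n, dif_pos (hw x hx)]
  have hwB : ∀ x ∈ D, w x = toL2 (toBCF (besselSeq r (F x))) := fun x hx => by
    rw [toL2_toBCF, bessel_besselSeq r (hcoD x hx), synth_fourierSeq]
  have hnB : ∀ x ∈ D, synth (potential (fourierSeq (w x))) =
      toL2 (toBCF (potential (besselSeq r (F x)))) := fun x hx => by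
    rw [toL2_toBCF, bessel_potential, bessel_besselSeq r (hcoD x hx)]
  have hcurl : ∀ x ∈ D, HTilde.curl (HTilde.mk (n x)) = w x := fun x hx => by
    rw [HTilde.curl_mk, hn x hx]
  have hFc : ContinuousOn (fun x => (F x).1.1) D :=
    (contDiff_coe_PerC2.fst.continuous.comp_continuousOn hF.1).mono subset_closure
  have hwc : ContinuousOn w D := fun x hx =>
    ContinuousAt.comp_continuousWithinAt (g := cellSol r) (f := fun x => (F x).1.1)
      (contDiffAt_cellSol r (hcoD x hx)).continuousAt (hFc x hx)
  have hM : ContinuousOn (fun x => HTilde.mk (n x)) D :=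
    -- The norm of a class is that of its curl, so continuity of `w` suffices.
    HTilde.isometry_curl.isUniformInducing.isInducing.continuousOn_iff.2 (hwc.congr hcurl)
  have hae : ∀ᵐ x ∂(volume.restrict D), N x = HTilde.mk (n x) :=
    ae_eq_of_isCellSolution hD hFc haF hc₁ hge hN hM fun x hx v hv => by
      rw [hcurl x hx]
      exact (cellSol_spec r (hcoD x hx)).2 v hv
  refine ⟨fun x y => toBCF (besselSeq r (F x)) y,
    fun x y => toBCF (potential (besselSeq r (F x))) y, n, ?_, memC1C_toBCF hd, memC1H2_toBCF hd,
    fun x hx => ⟨?_, ?_⟩, ?_, fun x hx => ⟨?_, ?_⟩, memC1C_toBCF hd', memC1H2_toBCF hd'⟩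
  · filter_upwards [hae, ae_restrict_mem hD.measurableSet] with x hx hxD
    rw [hx, hcurl x hxD, hwB x hxD]
    exact coeFn_toL2 _
  · rw [hn x hx, hnB x hx]
    exact coeFn_toL2 _
  · rw [hn x hx, hwB x hx]
    exact coeFn_toL2 _
  · filter_upwards [hae] with x hx using hx.symm
  · have h := isPerDivFree_potential (fourierSeq (w x))
    rw [hnB x hx] at h
    exact h.congr (coeFn_toL2 _)
  · have h := integral_potential (fourierSeq (w x))
    rw [hnB x hx, integral_congr_ae (coeFn_toL2 _)] at h
    exact h
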